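/- **Theorem (Groszek–Slaman, strengthened form).** Let $V$ be a transitive model of $\mathsf{ZFC}$ (for instance the universe of all sets), and let $W\subseteq V$ be an inner model of $V$, that is, a transitive subclass of $V$ which contains all ordinals of $V$ and satisfies $\mathsf{ZF}$. Suppose that $W\models\mathsf{CH}$, in the form $2^{\aleph_0}=\aleph_1$: in $W$ there is a bijection from $\omega_1$ onto the set ${}^{\omega}2$ of all reals. If ${}^{\omega}2\cap V\setminus W\neq\varnothing$, i.e. $V$ has a real which is not in $W$, then $$V\models {}^{\omega}2\cap W\in s^0 ,$$ where $s^0$ is the Marczewski ideal. In other words: for every perfect tree $T\subseteq{}^{<\omega}2$ in $V$ there is a perfect tree $S\subseteq T$ in $V$ such that no branch $x\in[S]$ in $V$ belongs to $W$. (A perfect tree is a nonempty subset of ${}^{<\omega}2$, closed under initial segments, in which every node has two incompatible extensions; $[S]$ is the set of all $x\in{}^{\omega}2$ all of whose finite initial segments lie in $S$.) -/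

import Mathlib

universe u

namespace InnerModels

/-! ### Models of set theory -/

/-- The relation symbols of the language of set theory: a single binary symbol. -/
inductive SetRel : ℕ → Type
  | mem : SetRel 2

/-- The first-order language of set theory. -/
def setLanguage : FirstOrder.Language.{0, 0} := ⟨fun _ => Empty, SetRel⟩

/-- A type with a binary relation `E`, read as a structure for the language of set theory. -/
@[reducible] def setStructure {M : Type*} (E : M → M → Prop) : setLanguage.Structure M where
  funMap := fun f _ => nomatch f
  RelMap := fun r v => match r, v with
    | SetRel.mem, v => E (v 0) (v 1)

/-- Satisfaction in `(M, E)` of a formula of set theory, whose free variables are indexed by `ℕ`,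
under the assignment `v`. -/
def Satisfies {M : Type*} (E : M → M → Prop) (φ : setLanguage.Formula ℕ) (v : ℕ → M) : Prop :=
  @FirstOrder.Language.Formula.Realize setLanguage M (setStructure E) ℕ φ v

/-- The assignment `x, v 0, v 1, v 2, …`. -/
def push {M : Type*} (x : M) (v : ℕ → M) : ℕ → M
  | 0 => x
  | n + 1 => v n

/-- `(M, E)` is a model of Zermelo–Fraenkel set theory. In the two schemes `φ` ranges over all
first-order formulas of set theory and `v` supplies the parameters. -/
structure IsZFModel {M : Type*} (E : M → M → Prop) : Prop where
  extensionality : ∀ x y, (∀ z, E z x ↔ E z y) → x = y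
  foundation : ∀ x, (∃ y, E y x) → ∃ y, E y x ∧ ∀ z, ¬ (E z x ∧ E z y)
  pairing : ∀ x y, ∃ p, ∀ z, E z p ↔ z = x ∨ z = y
  union : ∀ x, ∃ w, ∀ z, E z w ↔ ∃ y, E y x ∧ E z y
  powerset : ∀ x, ∃ p, ∀ z, E z p ↔ ∀ w, E w z → E w x
  infinity : ∃ I, (∃ e, (∀ z, ¬ E z e) ∧ E e I) ∧
    ∀ x, E x I → ∃ s, (∀ z, E z s ↔ E z x ∨ z = x) ∧ E s I
  separation : ∀ (φ : setLanguage.Formula ℕ) (v : ℕ → M) (a : M),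
    ∃ b, ∀ x, E x b ↔ E x a ∧ Satisfies E φ (push x v)
  replacement : ∀ (φ : setLanguage.Formula ℕ) (v : ℕ → M) (a : M),
    (∀ x, E x a → ∃! y, Satisfies E φ (push x (push y v))) →
      ∃ b, ∀ y, E y b ↔ ∃ x, E x a ∧ Satisfies E φ (push x (push y v))

/-- `(M, E)` is a model of `ZFC`: it is a model of `ZF` in which every family of pairwise disjoint
nonempty sets has a choice set. -/
structure IsZFCModel {M : Type*} (E : M → M → Prop) : Prop extends IsZFModel E where
  choice : ∀ F, (∀ x, E x F → ∃ y, E y x) →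
    (∀ x y z, E x F → E y F → E z x → E z y → x = y) →
      ∃ C, ∀ x, E x F → ∃! y, E y x ∧ E y C

/-- The membership relation restricted to a class `M` of sets. -/
def memOn (M : Set ZFSet.{u}) (x y : M) : Prop := (x : ZFSet.{u}) ∈ (y : ZFSet.{u})

/-- A class containing all elements of its elements. -/
def IsTransitiveClass (M : Set ZFSet.{u}) : Prop := ∀ x ∈ M, ∀ y ∈ x, y ∈ M

/-- `V` is a transitive model of `ZFC`. -/
structure IsTransitiveZFCModel (V : Set ZFSet.{u}) : Prop where
  transitive : IsTransitiveClass V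
  zfc : IsZFCModel (memOn V)

/-- `W` is an inner model of `V`: a transitive subclass of `V` that contains all ordinals of `V`
and satisfies `ZF`. -/
structure IsInnerModel (W V : Set ZFSet.{u}) : Prop where
  subset : W ⊆ V
  transitive : IsTransitiveClass W
  ordinals : ∀ α ∈ V, α.IsOrdinal → α ∈ W
  zf : IsZFModel (memOn W)

/-! ### Reals and trees -/

/-- The ordinal `2 = {0, 1}`. -/
def two : ZFSet.{u} := {∅, {∅}}

/-- `x` is a real, that is, an element of `2^ω` (a function from `ω` to `2`, as a set of pairs). -/
def IsReal (x : ZFSet.{u}) : Prop := ZFSet.IsFunc ZFSet.omega two x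

/-- The reals lying in the class `M`. -/
def realsOf (M : Set ZFSet.{u}) : Set ZFSet.{u} := {x | x ∈ M ∧ IsReal x}

/-- `s` is an element of `2^{<ω}`, a function from some `n ∈ ω` to `2`. For such functions (and
for reals), `s ⊆ t` says that `s` is an initial segment of `t`. -/
def IsNode (s : ZFSet.{u}) : Prop := ∃ n ∈ ZFSet.omega, ZFSet.IsFunc n two s

/-- `T` is a tree: a subset of `2^{<ω}` closed under initial segments. -/
def IsTree (T : ZFSet.{u}) : Prop :=
  (∀ s ∈ T, IsNode s) ∧ ∀ s ∈ T, ∀ t, IsNode t → t ⊆ s → t ∈ T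

/-- `T` is a perfect tree: a nonempty tree in which every node has two incompatible extensions. -/
def IsPerfectTree (T : ZFSet.{u}) : Prop :=
  IsTree T ∧ T.Nonempty ∧
    ∀ s ∈ T, ∃ t ∈ T, ∃ t' ∈ T, s ⊆ t ∧ s ⊆ t' ∧ ¬ t ⊆ t' ∧ ¬ t' ⊆ t

/-- `x ∈ [T]`: `x` is a real all of whose finite initial segments belong to `T`. -/
def IsBranch (T x : ZFSet.{u}) : Prop := IsReal x ∧ ∀ s, IsNode s → s ⊆ x → s ∈ T

/-- In `V`, the set of reals `X` belongs to the Marczewski ideal `s⁰`: every perfect tree has a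
perfect subtree `S` with `[S] ∩ X = ∅`. -/
def InMarczewskiIdeal (V X : Set ZFSet.{u}) : Prop :=
  ∀ T ∈ V, IsPerfectTree T →
    ∃ S ∈ V, IsPerfectTree S ∧ S ⊆ T ∧ ∀ x ∈ V, IsBranch S x → x ∉ X

/-! ### The continuum hypothesis in a transitive class -/

/-- `f` is an injective function from `a` to `b`. -/
def IsInjection (a b f : ZFSet.{u}) : Prop :=
  ZFSet.IsFunc a b f ∧
    ∀ x y z, ZFSet.pair x z ∈ f → ZFSet.pair y z ∈ f → x = y

/-- `f` is a bijective function from `a` to `b`. -/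
def IsBijection (a b f : ZFSet.{u}) : Prop :=
  IsInjection a b f ∧ ∀ y ∈ b, ∃ x ∈ a, ZFSet.pair x y ∈ f

/-- `a` is countable in `M`. -/
def CountableIn (M : Set ZFSet.{u}) (a : ZFSet.{u}) : Prop :=
  ∃ f ∈ M, IsInjection a ZFSet.omega f

/-- `κ` is `ω₁` in the sense of `M`: the least ordinal that is not countable in `M`. -/
def IsOmegaOneOf (M : Set ZFSet.{u}) (κ : ZFSet.{u}) : Prop :=
  κ ∈ M ∧ κ.IsOrdinal ∧ ¬ CountableIn M κ ∧ ∀ α ∈ κ, CountableIn M α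

/-- `M` satisfies `CH`, that is, `2^{ℵ₀} = ℵ₁`: in `M` there is a bijection from `ω₁` onto the set
of all reals. -/
def SatisfiesCH (M : Set ZFSet.{u}) : Prop :=
  ∃ κ, IsOmegaOneOf M κ ∧ ∃ R ∈ M, (∀ x, x ∈ R ↔ x ∈ realsOf M) ∧
    ∃ f ∈ M, IsBijection κ R f

end InnerModels

/-! Fix a perfect tree T in V. CH in W gives an enumeration f of the reals of W whose length κ is ω₁
of W. Every proper initial segment of f is countable in W, hence is coded by the rows of a single
real of W (`exists_cover`).

Suppose V has a countable enumeration of those reals of W that are branches of T through some fixed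
node. Then a perfect subtree avoids them by diagonalization (`exists_ptree_avoiding_rows`). Suppose
there is no such enumeration. Then, for any countable sequence of reals in V, every node s of T lies
on a branch of T that is in W and outside the sequence; let β_s be the least index of one in f. If
the β_s were unbounded in κ, the countably many reals coding the segments of f up to β_s would
enumerate all reals of W in V (`exists_bound_or_enumeration`). So they are bounded, and one real of
W has rows of this kind through every node. Two applications (`exists_enumeration_or_dense`) give r₁
and then r₂ in W, with the dense branches from r₂ outside the rows of r₁. Merge them into X and
colour a row by whether it occurs in r₁: X and the colouring `Par` are in W, and both colours are
dense in T.

Now let c be a real of V outside W. From c one builds in V two perfect subtrees of T such that any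
branch x of one and y of the other compute c from X and `Par` (`exists_ptree_avoiding`). Hence the
two trees cannot both have a branch in W. The trees take turns. The nodes of the tree whose turn it
is are aimed at rows of X whose colour is the next bit of c and whose indices exceed all earlier
targets. They then follow these rows so far that they outlast the next nodes of the other tree,
which have by then left every row before their own targets. When x and y are compared by how long
they agree with the first n + 1 rows, the lead therefore changes sides exactly at the indices t₀ <
t₁ < ... of the targets met. So x and y determine the t_j, and the colour of t_j is the j-th bit of
c (`ar_decode`).

Membership in V or W is handled through definability. Families of sets of numbers definable over a
transitive model are closed under arithmetical operations (`IsTransitiveZF.arithClosed`), and a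
definable set of numbers is a real of the model (`realOf_mem`). Each construction thus only has to
be seen to be arithmetical in its data. -/

namespace InnerModels

open FirstOrder.Language

/-! ### Definable predicates -/

section Definability

variable {M : Set ZFSet.{u}}

/-- A class of sets, as a structure for the language of set theory. -/
@[reducible] instance classStructure (M : Set ZFSet.{u}) : setLanguage.Structure M :=
  setStructure (memOn M)

/-- A predicate on assignments is definable if it is given by a formula with parameters in `M`. -/
def Def (P : (ℕ → M) → Prop) : Prop :=
  ∃ φ : setLanguage.Formula (ℕ ⊕ M), ∀ v : ℕ → M,
    φ.Realize (Sum.elim v id) ↔ P v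

/-- A term is a variable or a parameter. -/
def Tm (t : (ℕ → M) → M) : Prop := ∃ a : ℕ ⊕ M, ∀ v, t v = Sum.elim v id a

theorem Tm.var (i : ℕ) : Tm (fun v : ℕ → M => v i) := ⟨Sum.inl i, fun _ => rfl⟩

theorem Tm.const (c : M) : Tm (fun _ : ℕ → M => c) := ⟨Sum.inr c, fun _ => rfl⟩

theorem Def.congr {P Q : (ℕ → M) → Prop} (hP : Def P) (h : ∀ v, P v ↔ Q v) : Def Q := by
  obtain ⟨φ, hφ⟩ := hP
  exact ⟨φ, fun v => (hφ v).trans (h v)⟩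

theorem Def.mem {s t : (ℕ → M) → M} (hs : Tm s) (ht : Tm t) :
    Def (fun v => (s v : ZFSet.{u}) ∈ (t v : ZFSet.{u})) := by
  obtain ⟨a, ha⟩ := hs
  obtain ⟨b, hb⟩ := ht
  let r : setLanguage.Relations 2 := SetRel.mem
  refine ⟨r.formula ![Term.var a, Term.var b], fun v => ?_⟩
  beta_reduce
  rw [Formula.realize_rel, ha, hb]
  rfl

theorem Def.eq {s t : (ℕ → M) → M} (hs : Tm s) (ht : Tm t) : Def (fun v => s v = t v) := by
  obtain ⟨a, ha⟩ := hs
  obtain ⟨b, hb⟩ := ht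
  refine ⟨Term.equal (Term.var a) (Term.var b), fun v => ?_⟩
  beta_reduce
  rw [Formula.realize_equal, ha, hb]
  rfl

theorem Def.not {P : (ℕ → M) → Prop} (hP : Def P) : Def (fun v => ¬ P v) := by
  obtain ⟨φ, hφ⟩ := hP
  exact ⟨φ.not, fun v => by rw [Formula.realize_not, hφ]⟩

theorem Def.imp {P Q : (ℕ → M) → Prop} (hP : Def P) (hQ : Def Q) : Def (fun v => P v → Q v) := by
  obtain ⟨φ, hφ⟩ := hP
  obtain ⟨ψ, hψ⟩ := hQ
  exact ⟨φ.imp ψ, fun v => by rw [Formula.realize_imp, hφ, hψ]⟩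

theorem Def.and {P Q : (ℕ → M) → Prop} (hP : Def P) (hQ : Def Q) : Def (fun v => P v ∧ Q v) :=
  (hP.imp hQ.not).not.congr fun v => by tauto

theorem Def.or {P Q : (ℕ → M) → Prop} (hP : Def P) (hQ : Def Q) : Def (fun v => P v ∨ Q v) :=
  (hP.not.imp hQ).congr fun v => by tauto

theorem Def.iff {P Q : (ℕ → M) → Prop} (hP : Def P) (hQ : Def Q) : Def (fun v => P v ↔ Q v) :=
  ((hP.imp hQ).and (hQ.imp hP)).congr fun v => by tauto

/-- Renames variables and inserts parameters at once; this is how a relation shown definable in its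
first few variables is applied to arbitrary terms. -/
theorem Def.subst {P : (ℕ → M) → Prop} (hP : Def P) (t : ℕ → (ℕ → M) → M)
    (ht : ∀ i, Tm (t i)) : Def (fun v => P (fun i => t i v)) := by
  obtain ⟨φ, hφ⟩ := hP
  choose a ha using ht
  refine ⟨φ.relabel (Sum.elim a Sum.inr), fun v => ?_⟩
  beta_reduce
  rw [Formula.realize_relabel, ← hφ]
  refine iff_of_eq (congrArg _ ?_)
  funext x
  cases x with
  | inl i => exact (ha i v).symm
  | inr m => rfl

/-- De Bruijn convention: the bound variable takes index 0 and the outer variables move up by one,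
so indices in `Tm.var` grow under each quantifier. -/
theorem Def.ex {P : M → (ℕ → M) → Prop} (hP : Def (fun v => P (v 0) (fun n => v (n + 1)))) :
    Def (fun v => ∃ x, P x v) := by
  obtain ⟨φ, hφ⟩ := hP
  let g : ℕ ⊕ M → (ℕ ⊕ M) ⊕ Unit := fun a => match a with
    | Sum.inl 0 => Sum.inr ()
    | Sum.inl (n + 1) => Sum.inl (Sum.inl n)
    | Sum.inr m => Sum.inl (Sum.inr m)
  have key : ∀ (x : M) (v : ℕ → M),
      (φ.relabel g).Realize (Sum.elim (Sum.elim v id) (fun _ => x)) ↔ P x v := by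
    intro x v
    rw [Formula.realize_relabel]
    have := hφ (push x v)
    have e : (Sum.elim (Sum.elim v id) (fun _ => x) ∘ g : ℕ ⊕ M → M) =
        Sum.elim (push x v) id := by
      funext a
      rcases a with (_ | n) | m <;> rfl
    rw [e]
    exact this
  refine ⟨(φ.relabel g).iExs Unit, fun v => ?_⟩
  rw [Formula.realize_iExs]
  exact ⟨fun ⟨i, hi⟩ => ⟨i (), (key _ v).1 hi⟩, fun ⟨x, hx⟩ => ⟨fun _ => x, (key x v).2 hx⟩⟩

theorem Def.all {P : M → (ℕ → M) → Prop} (hP : Def (fun v => P (v 0) (fun n => v (n + 1)))) :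
    Def (fun v => ∀ x, P x v) :=
  (Def.ex (P := fun x v => ¬ P x v) hP.not).not.congr fun v => by simp

theorem Def.rel₂ {Q : M → M → Prop} (hQ : Def (fun v => Q (v 0) (v 1))) {s t : (ℕ → M) → M}
    (hs : Tm s) (ht : Tm t) : Def (fun v => Q (s v) (t v)) :=
  hQ.subst (fun i => if i = 0 then s else t) fun i => by split_ifs <;> assumption

theorem Def.rel₃ {Q : M → M → M → Prop} (hQ : Def (fun v => Q (v 0) (v 1) (v 2)))
    {s t r : (ℕ → M) → M} (hs : Tm s) (ht : Tm t) (hr : Tm r) :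
    Def (fun v => Q (s v) (t v) (r v)) :=
  hQ.subst (fun i => if i = 0 then s else if i = 1 then t else r)
    fun i => by split_ifs <;> assumption

/-- A definable predicate is given by a formula in the variables `x, y` and finitely many
parameters. -/
theorem Def.exists_formula {P : (ℕ → M) → Prop} (hP : Def P) (v₀ : ℕ → M) :
    ∃ (φ : setLanguage.Formula ℕ) (p : ℕ → M), ∀ x y : M,
      Satisfies (memOn M) φ (push x (push y p)) ↔ P (push x (push y v₀)) := by
  classical
  obtain ⟨φ, hφ⟩ := hP
  -- Only finitely many variables occur. The variables x and y keep slots 0 and 1; parameters and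
  -- the remaining variables, frozen at `v₀`, move to slots from 2 on, where `p` supplies their
  -- values. The default `v₀ 0` is never read.
  let s := BoundedFormula.freeVarFinset φ
  let e := Fintype.equivFin s
  let f : s → ℕ := fun a => match a.1 with
    | Sum.inl 0 => 0
    | Sum.inl 1 => 1
    | _ => e a + 2
  let p : ℕ → M := fun n => if h : n < Fintype.card s then
    (match (e.symm ⟨n, h⟩).1 with
    | Sum.inl (k + 2) => v₀ k
    | Sum.inl _ => v₀ 0
    | Sum.inr m => m) else v₀ 0
  refine ⟨BoundedFormula.restrictFreeVar φ f, p, fun x y => ?_⟩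
  rw [← hφ]
  unfold Satisfies Formula.Realize
  apply BoundedFormula.realize_restrictFreeVar
  rintro ⟨a, ha⟩
  rcases a with (_ | _ | k) | m
  · rfl
  · rfl
  · have : p (e ⟨Sum.inl (k + 2), ha⟩) = v₀ k := by
      simp only [p, (e _).is_lt, dite_true, Fin.eta, Equiv.symm_apply_apply]
    exact this
  · have : p (e ⟨Sum.inr m, ha⟩) = m := by
      simp only [p, (e _).is_lt, dite_true, Fin.eta, Equiv.symm_apply_apply]
    exact this

theorem IsZFModel.sep (hz : IsZFModel (memOn M)) {P : M → Prop} (hP : Def fun v => P (v 0))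
    (a : M) : ∃ b : M, ∀ x : M, (x : ZFSet.{u}) ∈ (b : ZFSet.{u}) ↔ x.1 ∈ a.1 ∧ P x := by
  obtain ⟨φ, p, hφ⟩ := hP.exists_formula (fun _ => a)
  obtain ⟨b, hb⟩ := hz.separation φ (push a p) a
  refine ⟨b, fun x => (hb x).trans ?_⟩
  exact and_congr Iff.rfl (hφ x a)

theorem IsZFModel.repl (hz : IsZFModel (memOn M)) {P : M → M → Prop}
    (hP : Def fun v => P (v 0) (v 1)) (a : M) (h : ∀ x : M, x.1 ∈ a.1 → ∃! y, P x y) :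
    ∃ b : M, ∀ y : M, (y : ZFSet.{u}) ∈ (b : ZFSet.{u}) ↔ ∃ x : M, x.1 ∈ a.1 ∧ P x y := by
  obtain ⟨φ, p, hφ⟩ := hP.exists_formula (fun _ => a)
  have h' : ∀ x y : M, Satisfies (memOn M) φ (push x (push y p)) ↔ P x y := hφ
  obtain ⟨b, hb⟩ := hz.replacement φ p a (fun x hx => by simpa only [h'] using h x hx)
  refine ⟨b, fun y => (hb y).trans ?_⟩
  simp only [h']
  rfl

end Definability

/-! ### Natural numbers and basic closure properties of transitive models -/

/-- The von Neumann numeral `n`. -/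
noncomputable def num : ℕ → ZFSet.{u}
  | 0 => ∅
  | n + 1 => insert (num n) (num n)

theorem mem_num {n : ℕ} {x : ZFSet.{u}} : x ∈ num n ↔ ∃ m < n, x = num m := by
  induction n with
  | zero => simp [num]
  | succ n ih =>
    rw [num, ZFSet.mem_insert_iff, ih]
    constructor
    · rintro (rfl | ⟨m, hm, rfl⟩)
      · exact ⟨n, n.lt_succ_self, rfl⟩
      · exact ⟨m, hm.trans n.lt_succ_self, rfl⟩
    · rintro ⟨m, hm, rfl⟩
      rcases (Nat.lt_succ_iff_lt_or_eq.1 hm) with h | rfl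
      · exact Or.inr ⟨m, h, rfl⟩
      · exact Or.inl rfl

theorem num_injective : Function.Injective num.{u} := by
  have key : ∀ m n, m < n → num.{u} m ≠ num n := fun m n h e => by
    have : num.{u} m ∈ num.{u} n := mem_num.2 ⟨m, h, rfl⟩
    rw [e] at this
    exact ZFSet.mem_irrefl _ this
  intro m n h
  rcases lt_trichotomy m n with hl | he | hl
  · exact (key m n hl h).elim
  · exact he
  · exact (key n m hl h.symm).elim

theorem num_inj {m n : ℕ} : num.{u} m = num n ↔ m = n := num_injective.eq_iff

theorem num_mem_num {m n : ℕ} : num.{u} m ∈ num.{u} n ↔ m < n := by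
  simp only [mem_num, num_inj]
  exact ⟨fun ⟨k, hk, e⟩ => e ▸ hk, fun h => ⟨m, h, rfl⟩⟩

theorem mem_omega {x : ZFSet.{u}} : x ∈ ZFSet.omega ↔ ∃ n, x = num n := by
  constructor
  · have key : ∀ n : ℕ, ZFSet.mk (PSet.ofNat.{u} n) = num n := by
      intro n
      induction n with
      | zero => rfl
      | succ n ih => rw [num, ← ih]; rfl
    refine Quotient.inductionOn x fun y hy => ?_
    obtain ⟨⟨n⟩, hn⟩ := hy
    exact ⟨n, (ZFSet.sound hn).trans (key n)⟩
  · rintro ⟨n, rfl⟩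
    induction n with
    | zero => exact ZFSet.omega_zero
    | succ n ih => exact ZFSet.omega_succ ih

theorem num_mem_omega (n : ℕ) : num.{u} n ∈ ZFSet.omega := mem_omega.2 ⟨n, rfl⟩

theorem two_eq : two.{u} = num 2 := by
  have h1 : num.{u} 1 = {∅} := by
    ext z
    simp [num]
  ext z
  change z ∈ two ↔ z ∈ insert (num 1) (num 1)
  rw [ZFSet.mem_insert_iff, h1]
  simp only [two, ZFSet.mem_pair, ZFSet.mem_singleton]
  exact or_comm

/-- A transitive class that is a model of `ZF`. -/
structure IsTransitiveZF (M : Set ZFSet.{u}) : Prop where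
  transitive : IsTransitiveClass M
  zf : IsZFModel (memOn M)

section Definability

variable {M : Set ZFSet.{u}}

namespace IsTransitiveZF

/-- The absoluteness principle behind the closure properties: by transitivity, a witness that M has
for an axiom is the true set, provided the true set has all its elements in M. -/
theorem eq_of_mem_iff (h : IsTransitiveZF M) {a b : ZFSet.{u}} (hb : b ∈ M) (ha : ∀ x ∈ a, x ∈ M)
    (hab : ∀ x ∈ M, x ∈ b ↔ x ∈ a) : b = a := by
  ext z
  exact ⟨fun hz => (hab z (h.transitive b hb z hz)).1 hz, fun hz => (hab z (ha z hz)).2 hz⟩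

theorem upair_mem (h : IsTransitiveZF M) {x y : ZFSet.{u}} (hx : x ∈ M) (hy : y ∈ M) :
    ({x, y} : ZFSet.{u}) ∈ M := by
  obtain ⟨p, hp⟩ := h.zf.pairing ⟨x, hx⟩ ⟨y, hy⟩
  have := h.eq_of_mem_iff (a := {x, y}) p.2
    (by simp only [ZFSet.mem_pair]; rintro z (rfl | rfl) <;> assumption)
    (fun z hz => by
      have := hp ⟨z, hz⟩
      simp only [Subtype.mk.injEq, memOn] at this
      simpa only [ZFSet.mem_pair] using this)
  exact this ▸ p.2

theorem singleton_mem (h : IsTransitiveZF M) {x : ZFSet.{u}} (hx : x ∈ M) :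
    ({x} : ZFSet.{u}) ∈ M := by
  have := h.upair_mem hx hx
  rwa [ZFSet.pair_eq_singleton] at this

theorem sUnion_mem (h : IsTransitiveZF M) {x : ZFSet.{u}} (hx : x ∈ M) :
    (ZFSet.sUnion x : ZFSet.{u}) ∈ M := by
  obtain ⟨p, hp⟩ := h.zf.union ⟨x, hx⟩
  have := h.eq_of_mem_iff (a := ZFSet.sUnion x) p.2
    (by
      simp only [ZFSet.mem_sUnion]
      rintro z ⟨y, hy, hz⟩
      exact h.transitive _ (h.transitive _ hx _ hy) _ hz)
    (fun z hz => by
      rw [ZFSet.mem_sUnion]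
      refine (hp ⟨z, hz⟩).trans ⟨fun ⟨y, hy⟩ => ⟨y, hy⟩, fun ⟨y, hy, hz⟩ => ?_⟩
      exact ⟨⟨y, h.transitive _ hx _ hy⟩, hy, hz⟩)
  exact this ▸ p.2

theorem insert_mem (h : IsTransitiveZF M) {x y : ZFSet.{u}} (hx : x ∈ M) (hy : y ∈ M) :
    (insert x y : ZFSet.{u}) ∈ M := by
  have := h.sUnion_mem (h.upair_mem (h.singleton_mem hx) hy)
  have e : ZFSet.sUnion {{x}, y} = insert x y := by
    ext z
    simp [ZFSet.mem_insert_iff]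
  rwa [e] at this

theorem pair_mem (h : IsTransitiveZF M) {x y : ZFSet.{u}} (hx : x ∈ M) (hy : y ∈ M) :
    ZFSet.pair x y ∈ M :=
  h.upair_mem (h.singleton_mem hx) (h.upair_mem hx hy)

theorem fst_snd_mem (h : IsTransitiveZF M) {x y z : ZFSet.{u}} (hz : z ∈ M)
    (hxy : ZFSet.pair x y ∈ z) : x ∈ M ∧ y ∈ M := by
  have h1 := h.transitive _ hz _ hxy
  have h2 : ({x, y} : ZFSet.{u}) ∈ M := h.transitive _ h1 _ (by simp [ZFSet.pair])
  exact ⟨h.transitive _ h2 _ (by simp), h.transitive _ h2 _ (by simp)⟩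

theorem exists_inductive (h : IsTransitiveZF M) : ∃ I ∈ M, ∀ n, num n ∈ I := by
  obtain ⟨I, ⟨e, he, heI⟩, hI⟩ := h.zf.infinity
  refine ⟨I, I.2, fun n => ?_⟩
  induction n with
  | zero =>
    have : (e : ZFSet.{u}) = ∅ := by
      refine h.eq_of_mem_iff e.2 (by simp) fun x hx => ?_
      simpa [memOn] using he ⟨x, hx⟩
    rw [num, ← this]
    exact heI
  | succ n ih =>
    have hn := h.transitive _ I.2 _ ih
    obtain ⟨s, hs, hsI⟩ := hI ⟨num n, hn⟩ ih
    have : (s : ZFSet.{u}) = insert (num n) (num n) := by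
      refine h.eq_of_mem_iff s.2 (fun x hx => ?_) fun x hx => ?_
      · exact h.transitive _ (h.insert_mem hn hn) _ hx
      · rw [ZFSet.mem_insert_iff, or_comm]
        simpa only [Subtype.mk.injEq, memOn] using hs ⟨x, hx⟩
    rw [num, ← this]
    exact hsI

theorem num_mem (h : IsTransitiveZF M) (n : ℕ) : num n ∈ M := by
  obtain ⟨I, hI, hn⟩ := h.exists_inductive
  exact h.transitive _ hI _ (hn n)

end IsTransitiveZF

/-- The element `num n` of a transitive model. -/
noncomputable def IsTransitiveZF.numM (h : IsTransitiveZF M) (n : ℕ) : M := ⟨num n, h.num_mem n⟩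

theorem IsTransitiveZF.def_eqUpair (h : IsTransitiveZF M) :
    Def (fun v : ℕ → M => (v 0).1 = ({(v 1).1, (v 2).1} : ZFSet.{u})) := by
  have : Def (fun v : ℕ → M => ∀ z : M, z.1 ∈ (v 0).1 ↔ (z = v 1 ∨ z = v 2)) :=
    Def.all (((Def.mem (Tm.var 0) (Tm.var 1))).iff
      ((Def.eq (Tm.var 0) (Tm.var 2)).or (Def.eq (Tm.var 0) (Tm.var 3))))
  refine this.congr fun v => ⟨fun H => ?_, fun H z => ?_⟩
  · refine h.eq_of_mem_iff (v 0).2 ?_ fun x hx => ?_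
    · simp only [ZFSet.mem_pair]
      rintro z (rfl | rfl)
      exacts [(v 1).2, (v 2).2]
    · rw [ZFSet.mem_pair]
      simpa only [Subtype.ext_iff] using H ⟨x, hx⟩
  · rw [H, ZFSet.mem_pair, Subtype.ext_iff, Subtype.ext_iff]

theorem Def.eqPair (h : IsTransitiveZF M) {r s t : (ℕ → M) → M} (hr : Tm r) (hs : Tm s)
    (ht : Tm t) : Def (fun v => (r v).1 = ZFSet.pair (s v).1 (t v).1) := by
  have key : Def (fun v : ℕ → M => (v 0).1 = ZFSet.pair (v 1).1 (v 2).1) := by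
    have : Def (fun v : ℕ → M => ∃ p : M, ∃ q : M, p.1 = ({(v 1).1, (v 1).1} : ZFSet.{u}) ∧
        q.1 = ({(v 1).1, (v 2).1} : ZFSet.{u}) ∧ (v 0).1 = ({p.1, q.1} : ZFSet.{u})) :=
      Def.ex (Def.ex (((h.def_eqUpair.rel₃ (Q := fun a b c : M => a.1 = {b.1, c.1})
        (Tm.var 1) (Tm.var 3) (Tm.var 3))).and
        ((h.def_eqUpair.rel₃ (Q := fun a b c : M => a.1 = {b.1, c.1})
          (Tm.var 0) (Tm.var 3) (Tm.var 4)).and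
        (h.def_eqUpair.rel₃ (Q := fun a b c : M => a.1 = {b.1, c.1})
          (Tm.var 2) (Tm.var 1) (Tm.var 0)))))
    refine this.congr fun v => ⟨?_, fun H => ?_⟩
    · rintro ⟨p, q, hp, hq, e⟩
      rw [e, hp, hq, ZFSet.pair_eq_singleton]
      rfl
    · refine ⟨⟨_, h.upair_mem (v 1).2 (v 1).2⟩, ⟨_, h.upair_mem (v 1).2 (v 2).2⟩, rfl, rfl, ?_⟩
      simp only [H, ZFSet.pair, ZFSet.pair_eq_singleton]
  exact key.rel₃ (Q := fun a b c : M => a.1 = ZFSet.pair b.1 c.1) hr hs ht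

theorem Def.pairMem (h : IsTransitiveZF M) {r s t : (ℕ → M) → M} (hr : Tm r) (hs : Tm s)
    (ht : Tm t) : Def (fun v => ZFSet.pair (s v).1 (t v).1 ∈ (r v).1) := by
  have : Def (fun v : ℕ → M => ∃ p : M, p.1 = ZFSet.pair (v 1).1 (v 2).1 ∧ p.1 ∈ (v 0).1) :=
    Def.ex ((Def.eqPair h (Tm.var 0) (Tm.var 2) (Tm.var 3)).and (Def.mem (Tm.var 0) (Tm.var 1)))
  refine ((this.congr (Q := fun v => ZFSet.pair (v 1).1 (v 2).1 ∈ (v 0).1)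
    fun v => ⟨?_, fun H => ?_⟩).rel₃ (Q := fun a b c : M => ZFSet.pair b.1 c.1 ∈ a.1) hr hs ht)
  · rintro ⟨p, e, hp⟩
    exact e ▸ hp
  · exact ⟨⟨_, h.transitive _ (v 0).2 _ H⟩, rfl, H⟩

theorem Def.eqSucc (h : IsTransitiveZF M) {r s : (ℕ → M) → M} (hr : Tm r) (hs : Tm s) :
    Def (fun v => (r v).1 = insert (s v).1 (s v).1) := by
  have : Def (fun v : ℕ → M => ∀ z : M, z.1 ∈ (v 0).1 ↔ (z = v 1 ∨ z.1 ∈ (v 1).1)) :=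
    Def.all (((Def.mem (Tm.var 0) (Tm.var 1))).iff
      ((Def.eq (Tm.var 0) (Tm.var 2)).or (Def.mem (Tm.var 0) (Tm.var 2))))
  refine ((this.congr (Q := fun v => (v 0).1 = insert (v 1).1 (v 1).1)
    fun v => ⟨fun H => ?_, fun H z => ?_⟩).rel₂
      (Q := fun a b : M => a.1 = insert b.1 b.1) hr hs)
  · refine h.eq_of_mem_iff (v 0).2 ?_ fun x hx => ?_
    · exact h.transitive _ (h.insert_mem (v 1).2 (v 1).2)
    · rw [ZFSet.mem_insert_iff]
      simpa only [Subtype.ext_iff] using H ⟨x, hx⟩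
  · rw [H, ZFSet.mem_insert_iff, Subtype.ext_iff]

/-- Definability of a predicate that is built from definable atoms by logical operations. -/
theorem Def.auto {P : (ℕ → M) → Prop} (h : Def P := by
    repeat' (first
      | exact Tm.var _
      | exact Tm.const _
      | assumption
      | (refine Def.rel₃ (by assumption) ?_ ?_ ?_)
      | (refine Def.rel₂ (by assumption) ?_ ?_)
      | (refine Def.eqPair (by assumption) ?_ ?_ ?_)
      | (refine Def.pairMem (by assumption) ?_ ?_ ?_)
      | (refine Def.eqSucc (by assumption) ?_ ?_)
      | (refine Def.mem ?_ ?_)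
      | (refine Def.eq ?_ ?_)
      | (refine Def.and ?_ ?_)
      | (refine Def.or ?_ ?_)
      | (refine Def.iff ?_ ?_)
      | (refine Def.not ?_)
      | (refine Def.all ?_)
      | (refine Def.ex ?_)
      | (refine Def.imp ?_ ?_))) : Def P := h

/-- The axiom of infinity gives an inductive set that may exceed ω. Separation keeps its transitive
elements with transitive members in which every member, and the element itself, is zero or a
successor; by ∈-induction these are the numerals. -/
theorem IsTransitiveZF.omega_mem (h : IsTransitiveZF M) : ZFSet.omega.{u} ∈ M := by
  obtain ⟨I, hI, hn⟩ := h.exists_inductive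
  let e : M := h.numM 0
  have hd : Def (fun v : ℕ → M => (∀ y : M, y.1 ∈ (v 0).1 → ∀ z : M, z.1 ∈ y.1 → z.1 ∈ (v 0).1) ∧
    (∀ y : M, y.1 ∈ (v 0).1 → ∀ z : M, z.1 ∈ y.1 → ∀ w : M, w.1 ∈ z.1 → w.1 ∈ y.1) ∧
    ∀ y : M, (y = v 0 ∨ y.1 ∈ (v 0).1) → (y = e ∨ ∃ z : M, y.1 = insert z.1 z.1)) := Def.auto
  obtain ⟨b, hb⟩ := h.zf.sep (P := fun x : M =>
    (∀ y : M, y.1 ∈ x.1 → ∀ z : M, z.1 ∈ y.1 → z.1 ∈ x.1) ∧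
    (∀ y : M, y.1 ∈ x.1 → ∀ z : M, z.1 ∈ y.1 → ∀ w : M, w.1 ∈ z.1 → w.1 ∈ y.1) ∧
    ∀ y : M, (y = x ∨ y.1 ∈ x.1) → (y = e ∨ ∃ z : M, y.1 = insert z.1 z.1)) hd ⟨I, hI⟩
  have key : ∀ x : ZFSet.{u}, ∀ hx : x ∈ M,
    (∀ y : M, y.1 ∈ x → ∀ z : M, z.1 ∈ y.1 → z.1 ∈ x) ∧
    (∀ y : M, y.1 ∈ x → ∀ z : M, z.1 ∈ y.1 → ∀ w : M, w.1 ∈ z.1 → w.1 ∈ y.1) ∧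
    (∀ y : M, (y = ⟨x, hx⟩ ∨ y.1 ∈ x) → (y = e ∨ ∃ z : M, y.1 = insert z.1 z.1)) →
    ∃ n, x = num n := by
    intro x
    induction x using ZFSet.inductionOn with
    | _ x ih =>
    rintro hx ⟨h1, h2, h3⟩
    rcases h3 ⟨x, hx⟩ (Or.inl rfl) with he | ⟨z, hz⟩
    · exact ⟨0, congrArg Subtype.val he⟩
    · have hzx : z.1 ∈ x := by
        change x = _ at hz
        rw [hz]
        exact ZFSet.mem_insert _ _
      have hz' : ∀ y : M, (y = z ∨ y.1 ∈ z.1) → y.1 ∈ x := by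
        rintro y (rfl | hy)
        · exact hzx
        · exact h1 z hzx y hy
      obtain ⟨n, hn⟩ := ih z.1 hzx z.2
        ⟨h2 z hzx, fun y hy => h2 y (h1 z hzx y hy), fun y hy => h3 y (Or.inr (hz' y hy))⟩
      exact ⟨n + 1, by rw [num, ← hn]; exact hz⟩
  have : (b : ZFSet.{u}) = ZFSet.omega := by
    refine h.eq_of_mem_iff b.2 (fun x hx => ?_) fun x hx => ?_
    · obtain ⟨n, rfl⟩ := mem_omega.1 hx
      exact h.num_mem n
    · rw [mem_omega]
      refine (hb ⟨x, hx⟩).trans ⟨fun H => key x hx H.2, ?_⟩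
      rintro ⟨n, rfl⟩
      refine ⟨hn n, ?_, ?_, ?_⟩
      · intro y hy z hz
        obtain ⟨m, hm, e⟩ := mem_num.1 hy
        rw [e] at hz
        obtain ⟨k, hk, e⟩ := mem_num.1 hz
        exact mem_num.2 ⟨k, hk.trans hm, e⟩
      · intro y hy z hz w hw
        obtain ⟨m, hm, e⟩ := mem_num.1 hy
        rw [e] at hz ⊢
        obtain ⟨k, hk, e⟩ := mem_num.1 hz
        rw [e] at hw
        obtain ⟨l, hl, e⟩ := mem_num.1 hw
        exact mem_num.2 ⟨l, hl.trans hk, e⟩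
      · intro y hy
        have : ∃ m, y.1 = num m := by
          rcases hy with rfl | hy
          · exact ⟨n, rfl⟩
          · obtain ⟨m, -, e⟩ := mem_num.1 hy
            exact ⟨m, e⟩
        obtain ⟨m, hm⟩ := this
        cases m with
        | zero => exact Or.inl (Subtype.ext hm)
        | succ m => exact Or.inr ⟨h.numM m, hm⟩
  exact this ▸ b.2

end Definability

/-! ### Definability of primitive recursive functions -/

section Definability

variable {M : Set ZFSet.{u}}

theorem Def.rel₄ {Q : M → M → M → M → Prop} (hQ : Def (fun v => Q (v 0) (v 1) (v 2) (v 3)))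
    {s t r q : (ℕ → M) → M} (hs : Tm s) (ht : Tm t) (hr : Tm r) (hq : Tm q) :
    Def (fun v => Q (s v) (t v) (r v) (q v)) :=
  hQ.subst (fun i => if i = 0 then s else if i = 1 then t else if i = 2 then r else q)
    fun i => by split_ifs <;> assumption

/-- The element `ω` of a transitive model. -/
noncomputable def IsTransitiveZF.omegaM (h : IsTransitiveZF M) : M := ⟨ZFSet.omega, h.omega_mem⟩

theorem IsTransitiveZF.exists_omega (h : IsTransitiveZF M) {P : M → Prop} :
    (∃ x : M, x.1 ∈ h.omegaM.1 ∧ P x) ↔ ∃ n, P (h.numM n) := by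
  constructor
  · rintro ⟨⟨x, hx⟩, hxo, hP⟩
    obtain ⟨n, rfl⟩ := mem_omega.1 hxo
    exact ⟨n, hP⟩
  · rintro ⟨n, hP⟩
    exact ⟨h.numM n, num_mem_omega n, hP⟩

/-- The graph of a unary function on `ℕ` is definable. -/
def Graph₁ (h : IsTransitiveZF M) (g : ℕ → ℕ) : Prop :=
  ∃ Q : M → M → Prop, Def (fun v => Q (v 0) (v 1)) ∧
    ∀ n m, Q (h.numM n) (h.numM m) ↔ g n = m

/-- The graph of a binary function on `ℕ` is definable. -/
def Graph₂ (h : IsTransitiveZF M) (g : ℕ → ℕ → ℕ) : Prop :=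
  ∃ Q : M → M → M → Prop, Def (fun v => Q (v 0) (v 1) (v 2)) ∧
    ∀ n m k, Q (h.numM n) (h.numM m) (h.numM k) ↔ g n m = k

/-- The graph of a ternary function on `ℕ` is definable. -/
def Graph₃ (h : IsTransitiveZF M) (g : ℕ → ℕ → ℕ → ℕ) : Prop :=
  ∃ Q : M → M → M → M → Prop, Def (fun v => Q (v 0) (v 1) (v 2) (v 3)) ∧
    ∀ n m k l, Q (h.numM n) (h.numM m) (h.numM k) (h.numM l) ↔ g n m k = l

/-- A value is certified by a set F of pairs, each of which is the initial one or is derived from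
another pair in F. F need not be a function: induction on n forces every pair in it to carry the
right value. -/
theorem Graph₂.rec (h : IsTransitiveZF M) {f : ℕ → ℕ} {G : ℕ → ℕ → ℕ → ℕ} (hf : Graph₁ h f)
    (hG : Graph₃ h G) : Graph₂ h (fun a n => Nat.rec (f a) (fun n y => G a n y) n) := by
  obtain ⟨Qf, dQf, hQf⟩ := hf
  obtain ⟨QG, dQG, hQG⟩ := hG
  let o := h.omegaM
  refine ⟨fun a n y => ∃ F : M, ZFSet.pair n.1 y.1 ∈ F.1 ∧ ∀ z : M, z.1 ∈ F.1 →
    (∃ y₀ : M, y₀.1 ∈ o.1 ∧ (Qf a y₀ ∧ z.1 = ZFSet.pair (h.numM 0).1 y₀.1)) ∨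
    ∃ i : M, i.1 ∈ o.1 ∧ ∃ y : M, y.1 ∈ o.1 ∧ ∃ y' : M, y'.1 ∈ o.1 ∧
      (QG a i y y' ∧ ZFSet.pair i.1 y.1 ∈ F.1 ∧
        ∃ i' : M, i'.1 = insert i.1 i.1 ∧ z.1 = ZFSet.pair i'.1 y'.1), ?_, ?_⟩
  · refine Def.ex (Def.and Def.auto (Def.all (Def.imp Def.auto (Def.or Def.auto ?_))))
    refine Def.ex (Def.and Def.auto (Def.ex (Def.and Def.auto (Def.ex (Def.and Def.auto
      (Def.and ?_ Def.auto))))))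
    exact dQG.rel₄ (Tm.var _) (Tm.var _) (Tm.var _) (Tm.var _)
  · intro a n y
    set H : ℕ → ℕ := fun n => Nat.rec (f a) (fun n y => G a n y) n with hH
    have hS : ∀ n, H (n + 1) = G a n (H n) := fun n => rfl
    simp only [o, h.exists_omega, hQf, hQG]
    constructor
    · rintro ⟨F, hy, hF⟩
      change H n = y
      induction n generalizing y with
      | zero =>
        rcases hF ⟨_, h.transitive _ F.2 _ hy⟩ hy with ⟨y₀, e, hz⟩ | ⟨i, y, y', -, -, i', hi, hz⟩
        · have := num_injective (ZFSet.pair_injective hz).2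
          rw [this, ← e]
          rfl
        · have := (ZFSet.pair_injective hz).1
          rw [hi] at this
          exact absurd (num_injective (a₁ := 0) (a₂ := i + 1) this) (by omega)
      | succ n ih =>
        rcases hF ⟨_, h.transitive _ F.2 _ hy⟩ hy with ⟨y₀, e, hz⟩ | ⟨i, y₁, y', e, hp, i', hi, hz⟩
        · have := (ZFSet.pair_injective hz).1
          exact absurd (num_injective (a₁ := n + 1) (a₂ := 0) this) (by omega)
        · have h1 := (ZFSet.pair_injective hz).1
          have h2 := num_injective (ZFSet.pair_injective hz).2
          rw [hi] at h1
          have h3 : n + 1 = i + 1 := num_injective h1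
          obtain rfl : n = i := by omega
          rw [hS, ih _ hp, e, h2]
    · rintro rfl
      have : ∀ n, ∃ F ∈ M, ∀ z, z ∈ F ↔ ∃ i ≤ n, z = ZFSet.pair (num i) (num (H i)) := by
        intro n
        induction n with
        | zero =>
          refine ⟨_, h.singleton_mem (h.pair_mem (h.num_mem 0) (h.num_mem (H 0))), fun z => ?_⟩
          rw [ZFSet.mem_singleton]
          refine ⟨fun e => ⟨0, le_rfl, e⟩, fun ⟨i, hi, e⟩ => ?_⟩
          obtain rfl : i = 0 := by omega
          exact e
        | succ n ih =>
          obtain ⟨F, hF, hz⟩ := ih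
          refine ⟨_, h.insert_mem (h.pair_mem (h.num_mem (n + 1)) (h.num_mem (H (n + 1)))) hF,
            fun z => ?_⟩
          rw [ZFSet.mem_insert_iff, hz]
          constructor
          · rintro (e | ⟨i, hi, e⟩)
            · exact ⟨_, le_rfl, e⟩
            · exact ⟨i, by omega, e⟩
          · rintro ⟨i, hi, e⟩
            rcases Nat.le_succ_iff.1 hi with hi | rfl
            · exact Or.inr ⟨i, hi, e⟩
            · exact Or.inl e
      obtain ⟨F, hFM, hF⟩ := this n
      refine ⟨⟨F, hFM⟩, (hF _).2 ⟨n, le_rfl, rfl⟩, fun z hz => ?_⟩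
      obtain ⟨i, hi, e⟩ := (hF _).1 hz
      cases i with
      | zero => exact Or.inl ⟨H 0, rfl, e⟩
      | succ i =>
        exact Or.inr ⟨i, H i, H (i + 1), rfl, (hF _).2 ⟨i, by omega, rfl⟩, h.numM (i + 1), rfl, e⟩

theorem Graph₁.const (h : IsTransitiveZF M) (c : ℕ) : Graph₁ h (fun _ => c) := by
  refine ⟨fun _ y => y = h.numM c, Def.auto, fun n m => ?_⟩
  simp only [IsTransitiveZF.numM, Subtype.mk.injEq, num_inj]
  exact eq_comm

theorem Graph₁.id (h : IsTransitiveZF M) : Graph₁ h (fun n => n) := by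
  refine ⟨fun x y => x = y, Def.auto, fun n m => ?_⟩
  simp only [IsTransitiveZF.numM, Subtype.mk.injEq, num_inj]

theorem Graph₁.succ (h : IsTransitiveZF M) : Graph₁ h (fun n => n + 1) := by
  refine ⟨fun x y => y.1 = insert x.1 x.1, Def.auto, fun n m => ?_⟩
  exact (num_inj (m := m) (n := n + 1)).trans eq_comm

theorem Graph₁.comp₂ (h : IsTransitiveZF M) {g : ℕ → ℕ → ℕ} {f₁ f₂ : ℕ → ℕ} (hg : Graph₂ h g)
    (h₁ : Graph₁ h f₁) (h₂ : Graph₁ h f₂) : Graph₁ h (fun n => g (f₁ n) (f₂ n)) := by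
  obtain ⟨Q, dQ, hQ⟩ := hg
  obtain ⟨Q₁, dQ₁, hQ₁⟩ := h₁
  obtain ⟨Q₂, dQ₂, hQ₂⟩ := h₂
  let o := h.omegaM
  refine ⟨fun x y => ∃ a : M, a.1 ∈ o.1 ∧ (Q₁ x a ∧ ∃ b : M, b.1 ∈ o.1 ∧ (Q₂ x b ∧ Q a b y)),
    Def.auto, fun n m => ?_⟩
  simp only [o, h.exists_omega, hQ, hQ₁, hQ₂]
  simp

theorem Graph₁.comp (h : IsTransitiveZF M) {g : ℕ → ℕ} {f : ℕ → ℕ} (hg : Graph₁ h g)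
    (hf : Graph₁ h f) : Graph₁ h (fun n => g (f n)) := by
  obtain ⟨Q, dQ, hQ⟩ := hg
  obtain ⟨Q₁, dQ₁, hQ₁⟩ := hf
  let o := h.omegaM
  refine ⟨fun x y => ∃ a : M, a.1 ∈ o.1 ∧ (Q₁ x a ∧ Q a y), Def.auto, fun n m => ?_⟩
  simp only [o, h.exists_omega, hQ, hQ₁]
  simp

theorem Graph₂.add (h : IsTransitiveZF M) : Graph₂ h (fun a b => a + b) := by
  have hG : Graph₃ h (fun _ _ y => y + 1) := by
    obtain ⟨Q, dQ, hQ⟩ := Graph₁.succ h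
    exact ⟨fun _ _ y z => Q y z, Def.auto, fun _ _ k l => hQ k l⟩
  convert Graph₂.rec h (Graph₁.id h) hG using 3 with a b
  induction b with
  | zero => rfl
  | succ n ih => simp only [← ih]; rfl

theorem Graph₂.mul (h : IsTransitiveZF M) : Graph₂ h (fun a b => a * b) := by
  have hG : Graph₃ h (fun a _ y => y + a) := by
    obtain ⟨Q, dQ, hQ⟩ := Graph₂.add h
    exact ⟨fun a _ y z => Q y a z, Def.auto, fun n _ k l => hQ k n l⟩
  convert Graph₂.rec h (Graph₁.const h 0) hG using 3 with a b
  induction b with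
  | zero => rfl
  | succ n ih => simp only [← ih]; rfl

theorem Graph₂.pair (h : IsTransitiveZF M) : Graph₂ h Nat.pair := by
  obtain ⟨Qa, da, ha⟩ := Graph₂.add h
  obtain ⟨Qm, dm, hm⟩ := Graph₂.mul h
  let o := h.omegaM
  refine ⟨fun a b y => (a.1 ∈ b.1 ∧ ∃ t : M, t.1 ∈ o.1 ∧ (Qm b b t ∧ Qa t a y)) ∨
    (¬ a.1 ∈ b.1 ∧ ∃ t : M, t.1 ∈ o.1 ∧ (Qm a a t ∧ ∃ s : M, s.1 ∈ o.1 ∧ (Qa t a s ∧ Qa s b y))),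
    Def.auto, fun a b y => ?_⟩
  simp only [o, h.exists_omega, ha, hm]
  simp only [IsTransitiveZF.numM, num_mem_num, Nat.pair]
  split_ifs with hab <;> simp [hab]

theorem Graph₁.left (h : IsTransitiveZF M) : Graph₁ h (fun n => n.unpair.1) := by
  obtain ⟨Q, dQ, hQ⟩ := Graph₂.pair h
  let o := h.omegaM
  refine ⟨fun n a => ∃ b : M, b.1 ∈ o.1 ∧ Q a b n, Def.auto, fun n a => ?_⟩
  simp only [o, h.exists_omega, hQ]
  constructor
  · rintro ⟨b, rfl⟩
    simp
  · rintro rfl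
    exact ⟨n.unpair.2, Nat.pair_unpair n⟩

theorem Graph₁.right (h : IsTransitiveZF M) : Graph₁ h (fun n => n.unpair.2) := by
  obtain ⟨Q, dQ, hQ⟩ := Graph₂.pair h
  let o := h.omegaM
  refine ⟨fun n a => ∃ b : M, b.1 ∈ o.1 ∧ Q b a n, Def.auto, fun n a => ?_⟩
  simp only [o, h.exists_omega, hQ]
  constructor
  · rintro ⟨b, rfl⟩
    simp
  · rintro rfl
    exact ⟨n.unpair.1, Nat.pair_unpair n⟩

/-- Makes every primitive recursive coding of pairs, lists and trees available inside the model. -/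
theorem Graph₁.of_primrec (h : IsTransitiveZF M) {g : ℕ → ℕ} (hg : Nat.Primrec g) :
    Graph₁ h g := by
  induction hg with
  | zero => exact Graph₁.const h 0
  | succ => exact Graph₁.succ h
  | left => exact Graph₁.left h
  | right => exact Graph₁.right h
  | pair _ _ hf hg => exact Graph₁.comp₂ h (Graph₂.pair h) hf hg
  | comp _ _ hf hg => exact Graph₁.comp h hf hg
  | @prec f g _ _ hf hg =>
    have hG : Graph₃ h (fun z y IH => g (Nat.pair z (Nat.pair y IH))) := by
      obtain ⟨Q, dQ, hQ⟩ := hg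
      obtain ⟨Qp, dp, hp⟩ := Graph₂.pair h
      let o := h.omegaM
      refine ⟨fun z y i w => ∃ a : M, a.1 ∈ o.1 ∧ (Qp y i a ∧ ∃ b : M, b.1 ∈ o.1 ∧
        (Qp z a b ∧ Q b w)), Def.auto, fun z y i w => ?_⟩
      simp only [o, h.exists_omega, hQ, hp]
      simp
    exact Graph₁.comp₂ h (Graph₂.rec h hf hG) (Graph₁.left h) (Graph₁.right h)

end Definability

/-! ### Arithmetical closure -/

section Arithmetic

variable {ι : Type*} {α β γ σ : Type*} [Primcodable α] [Primcodable β] [Primcodable γ]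
  [Primcodable σ]

/-- A collection of families of sets of natural numbers that is closed under arithmetical
definability. -/
structure ArithClosed (𝒞 : Set (ι → ℕ → Prop)) : Prop where
  zero : (fun _ n => n = 0) ∈ 𝒞
  not : ∀ {A}, A ∈ 𝒞 → (fun i n => ¬ A i n) ∈ 𝒞
  and : ∀ {A B}, A ∈ 𝒞 → B ∈ 𝒞 → (fun i n => A i n ∧ B i n) ∈ 𝒞
  preimage : ∀ {A} {g : ℕ → ℕ}, A ∈ 𝒞 → Nat.Primrec g → (fun i n => A i (g n)) ∈ 𝒞
  proj : ∀ {A}, A ∈ 𝒞 → (fun i n => ∃ m, A i (Nat.pair n m)) ∈ 𝒞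

/-- The predicate `P`, with codes in place of elements of `α`, belongs to `𝒞`. -/
def Ar (𝒞 : Set (ι → ℕ → Prop)) (P : ι → α → Prop) : Prop :=
  (fun i n => ∃ a, Encodable.decode n = some a ∧ P i a) ∈ 𝒞

variable {𝒞 : Set (ι → ℕ → Prop)}

theorem Ar.congr {P Q : ι → α → Prop} (hP : Ar 𝒞 P) (h : ∀ i a, P i a ↔ Q i a) : Ar 𝒞 Q := by
  have : P = Q := funext fun i => funext fun a => propext (h i a)
  exact this ▸ hP

theorem ar_nat {A : ι → ℕ → Prop} : Ar 𝒞 A ↔ A ∈ 𝒞 := by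
  simp [Ar]

theorem ArithClosed.of_primrecPred (h : ArithClosed 𝒞) {p : ℕ → Prop} (hp : PrimrecPred p) :
    (fun _ n => p n) ∈ 𝒞 := by
  classical
  have h1 : Nat.Primrec (fun n => if p n then 0 else 1) :=
    Primrec.nat_iff.1 (Primrec.ite hp (Primrec.const 0) (Primrec.const 1))
  have := h.preimage h.zero h1
  convert this using 4
  simp

theorem Ar.comp (h : ArithClosed 𝒞) {P : ι → β → Prop} (hP : Ar 𝒞 P) {g : α → β}
    (hg : Primrec g) : Ar 𝒞 (fun i a => P i (g a)) := by
  have h1 : Primrec (fun n : ℕ => (Encodable.decode (α := α) n).map g) :=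
    Primrec.option_map Primrec.decode (hg.comp Primrec.snd).to₂
  have h2 : Nat.Primrec (fun n : ℕ => Encodable.encode ((Encodable.decode (α := α) n).map g)) :=
    Primrec.nat_iff.1 (Primrec.encode.comp h1)
  -- The code of `none` is 0 and that of `some b` is one more than the code of b. So a nonzero value
  -- says that n decodes to some a, and its predecessor is the code of `g a`.
  have h3 : (fun _ n => n ≠ 0) ∈ 𝒞 := h.not h.zero
  have h4 : Nat.Primrec Nat.pred := Primrec.nat_iff.1 Primrec.pred
  have := h.preimage (h.and h3 (h.preimage hP h4)) h2
  unfold Ar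
  convert this using 3 with i n
  cases e : Encodable.decode (α := α) n with
  | none => simp
  | some a => simp

theorem Ar.of_primrec (h : ArithClosed 𝒞) {p : α → Prop} (hp : PrimrecPred p) :
    Ar 𝒞 (fun _ a => p a) := by
  have h2 : Ar 𝒞 (fun (_ : ι) (b : Bool) => b = true) := by
    refine h.of_primrecPred (p := fun n => ∃ b : Bool, Encodable.decode n = some b ∧ b = true) ?_
    have : PrimrecPred (fun n : ℕ => Encodable.decode (α := Bool) n = some true) :=
      Primrec.eq.comp Primrec.decode (Primrec.const _)
    refine this.of_eq fun n => by simp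
  classical
  obtain ⟨_, hd⟩ := hp
  exact (h2.comp h hd).congr fun i a => by simp

theorem Ar.and (h : ArithClosed 𝒞) {P Q : ι → α → Prop} (hP : Ar 𝒞 P) (hQ : Ar 𝒞 Q) :
    Ar 𝒞 (fun i a => P i a ∧ Q i a) := by
  have := h.and hP hQ
  unfold Ar
  convert this using 3 with i n
  cases e : Encodable.decode (α := α) n <;> simp

theorem Ar.not (h : ArithClosed 𝒞) {P : ι → α → Prop} (hP : Ar 𝒞 P) :
    Ar 𝒞 (fun i a => ¬ P i a) := by
  have hd : Ar 𝒞 (fun (_ : ι) (_ : α) => True) :=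
    Ar.of_primrec h ⟨fun _ => isTrue trivial, Primrec.const true⟩
  have := h.and hd (h.not hP)
  unfold Ar
  convert this using 3 with i n
  cases e : Encodable.decode (α := α) n <;> simp

theorem Ar.or (h : ArithClosed 𝒞) {P Q : ι → α → Prop} (hP : Ar 𝒞 P) (hQ : Ar 𝒞 Q) :
    Ar 𝒞 (fun i a => P i a ∨ Q i a) :=
  (((hP.not h).and h (hQ.not h)).not h).congr fun i a => by tauto

theorem Ar.imp (h : ArithClosed 𝒞) {P Q : ι → α → Prop} (hP : Ar 𝒞 P) (hQ : Ar 𝒞 Q) :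
    Ar 𝒞 (fun i a => P i a → Q i a) :=
  ((hP.and h (hQ.not h)).not h).congr fun i a => by tauto

theorem Ar.iff (h : ArithClosed 𝒞) {P Q : ι → α → Prop} (hP : Ar 𝒞 P) (hQ : Ar 𝒞 Q) :
    Ar 𝒞 (fun i a => P i a ↔ Q i a) :=
  ((hP.imp h hQ).and h (hQ.imp h hP)).congr fun i a => by tauto

theorem Ar.ex (h : ArithClosed 𝒞) {P : ι → α → β → Prop}
    (hP : Ar 𝒞 (fun i (p : α × β) => P i p.1 p.2)) : Ar 𝒞 (fun i a => ∃ b, P i a b) := by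
  have := h.proj hP
  unfold Ar
  convert this using 3 with i n
  simp only [Encodable.decode_prod_val, Nat.unpair_pair]
  constructor
  · rintro ⟨a, ha, b, hb⟩
    exact ⟨Encodable.encode b, (a, b), by simp [ha], hb⟩
  · rintro ⟨m, ⟨a, b⟩, hab, hP⟩
    refine ⟨a, ?_, b, hP⟩
    cases e : Encodable.decode (α := α) n with
    | none => simp [e] at hab
    | some a' =>
      simp only [e, Option.bind_some, Option.map_eq_some_iff, Prod.mk.injEq] at hab
      obtain ⟨_, _, rfl, _⟩ := hab
      rfl

theorem Ar.all (h : ArithClosed 𝒞) {P : ι → α → β → Prop}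
    (hP : Ar 𝒞 (fun i (p : α × β) => P i p.1 p.2)) : Ar 𝒞 (fun i a => ∀ b, P i a b) :=
  ((Ar.ex h (P := fun i a b => ¬ P i a b) (hP.not h)).not h).congr fun i a => by simp

theorem Ar.mem (h : ArithClosed 𝒞) {X : ι → Set β} {g : α → β} (hX : Ar 𝒞 (fun i b => b ∈ X i))
    (hg : Primrec g) : Ar 𝒞 (fun i a => g a ∈ X i) :=
  hX.comp h hg

theorem Ar.eq (h : ArithClosed 𝒞) {f g : α → β} (hf : Primrec f) (hg : Primrec g) :
    Ar 𝒞 (fun _ a => f a = g a) := by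
  classical
  exact Ar.of_primrec h (Primrec.eq.comp hf hg)

theorem Ar.le (h : ArithClosed 𝒞) {f g : α → ℕ} (hf : Primrec f) (hg : Primrec g) :
    Ar 𝒞 (fun _ a => f a ≤ g a) :=
  Ar.of_primrec h (Primrec.nat_le.comp hf hg)

theorem Ar.lt (h : ArithClosed 𝒞) {f g : α → ℕ} (hf : Primrec f) (hg : Primrec g) :
    Ar 𝒞 (fun _ a => f a < g a) :=
  Ar.of_primrec h (Primrec.nat_lt.comp hf hg)

theorem Ar.prefix (h : ArithClosed 𝒞) {f g : α → List β} (hf : Primrec f) (hg : Primrec g) :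
    Ar 𝒞 (fun _ a => f a <+: g a) :=
  (Ar.eq h hf (Primrec.list_take.comp (Primrec.list_length.comp hf) hg)).congr fun _ _ =>
    List.prefix_iff_eq_take.symm

theorem Ar.mem_list (h : ArithClosed 𝒞) {f : α → β} {g : α → List β} (hf : Primrec f)
    (hg : Primrec g) : Ar 𝒞 (fun _ a => f a ∈ g a) :=
  (Ar.ex h (P := fun _ a (n : ℕ) => (g a)[n]? = some (f a))
    (Ar.eq h (Primrec.list_getElem?.comp (hg.comp Primrec.fst) Primrec.snd)
      (Primrec.option_some.comp (hf.comp Primrec.fst)))).congr fun _ _ =>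
    List.mem_iff_getElem?.symm

/-- The default arguments here and in `ar_auto` read the claim off the syntax of the goal. Atoms
that they do not know must be among the local hypotheses, stated in exactly the product context in
which they occur under the quantifiers. -/
theorem primrec_auto {f : α → β} (h : Primrec f := by
    repeat' (first
      | with_reducible exact Primrec.id
      | with_reducible exact Primrec.fst
      | with_reducible exact Primrec.snd
      | with_reducible exact Primrec.const _
      | with_reducible assumption
      | (with_reducible refine Primrec.fst.comp ?_)
      | (with_reducible refine Primrec.snd.comp ?_)
      | (with_reducible refine Primrec.succ.comp ?_)
      | (with_reducible refine Primrec.encode.comp ?_)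
      | (with_reducible refine Primrec.option_some.comp ?_)
      | (with_reducible refine Primrec.list_length.comp ?_)
      | (with_reducible refine Primrec.list_getElem?.comp ?_ ?_)
      | (with_reducible refine Primrec.pair ?_ ?_)
      | (with_reducible refine (Primrec₂.natPair).comp ?_ ?_))) : Primrec f := h

theorem ar_auto (_h : ArithClosed 𝒞) {P : ι → α → Prop} (hP : Ar 𝒞 P := by
    repeat' (first
      | with_reducible assumption
      | (with_reducible refine Ar.eq (by assumption) primrec_auto primrec_auto)
      | (with_reducible refine Ar.le (by assumption) primrec_auto primrec_auto)
      | (with_reducible refine Ar.lt (by assumption) primrec_auto primrec_auto)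
      | (with_reducible refine Ar.mem_list (by assumption) primrec_auto primrec_auto)
      | (with_reducible refine Ar.prefix (by assumption) primrec_auto primrec_auto)
      | (with_reducible refine Ar.and (by assumption) ?_ ?_)
      | (with_reducible refine Ar.or (by assumption) ?_ ?_)
      | (with_reducible refine Ar.iff (by assumption) ?_ ?_)
      | (with_reducible refine Ar.not (by assumption) ?_)
      | (with_reducible refine Ar.all (by assumption) ?_)
      | (with_reducible refine Ar.ex (by assumption) ?_)
      | (with_reducible refine Ar.imp (by assumption) ?_ ?_)
      | (with_reducible refine Ar.mem (by assumption) (by assumption) primrec_auto))) : Ar 𝒞 P := hP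

/-- Dependent choice, with an arithmetical sequence. -/
theorem exists_sequence (h : ArithClosed 𝒞) {R : ℕ → σ → σ → Prop}
    (hR : Ar 𝒞 (fun _ (p : ℕ × σ × σ) => R p.1 p.2.1 p.2.2)) (Inv : ℕ → σ → Prop) (s₀ : σ)
    (h₀ : Inv 0 s₀) (hex : ∀ j s, Inv j s → ∃ s', R j s s')
    (hInv : ∀ j s s', Inv j s → R j s s' → Inv (j + 1) s') :
    ∃ st : ℕ → σ, st 0 = s₀ ∧ (∀ j, R j (st j) (st (j + 1))) ∧
      Ar 𝒞 (fun _ (p : ℕ × σ) => st p.1 = p.2) := by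
  classical
  -- The successor with least code is unique, so the sequence is defined and not merely chosen.
  let G : ℕ → σ → σ → Prop := fun j s s' => R j s s' ∧
    ∀ t, Encodable.encode t < Encodable.encode s' → ¬ R j s t
  have hG : ∀ j s, Inv j s → ∃ s', G j s s' := by
    intro j s hs
    let A : Set ℕ := {n | ∃ t, Encodable.encode t = n ∧ R j s t}
    have hA : ∃ n, n ∈ A := by
      obtain ⟨s', hs'⟩ := hex j s hs
      exact ⟨_, s', rfl, hs'⟩
    obtain ⟨t, ht, htR⟩ := Nat.find_spec hA
    refine ⟨t, htR, fun t' ht' hR' => ?_⟩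
    rw [ht] at ht'
    exact Nat.find_min hA ht' ⟨t', rfl, hR'⟩
  have hGu : ∀ j s t t', G j s t → G j s t' → t = t' := by
    intro j s t t' h1 h2
    refine Encodable.encode_injective (le_antisymm ?_ ?_)
    · exact not_lt.1 fun hl => h1.2 _ hl h2.1
    · exact not_lt.1 fun hl => h2.2 _ hl h1.1
  let f : ∀ j : ℕ, {s : σ // Inv j s} := fun j =>
    Nat.rec ⟨s₀, h₀⟩ (fun j s => ⟨Classical.choose (hG j s.1 s.2),
      hInv j s.1 _ s.2 (Classical.choose_spec (hG j s.1 s.2)).1⟩) j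
  have hf : ∀ j, G j (f j).1 (f (j + 1)).1 := fun j => Classical.choose_spec (hG j (f j).1 (f j).2)
  refine ⟨fun j => (f j).1, rfl, fun j => (hf j).1, ?_⟩
  have hRt : Ar 𝒞 (fun (_ : ι) (p : ℕ × σ × σ) => G p.1 p.2.1 p.2.2) := by
    have h1 : Ar 𝒞 (fun (_ : ι) (p : (ℕ × σ × σ) × σ) => R p.1.1 p.1.2.1 p.2) :=
      hR.comp h (g := fun p : (ℕ × σ × σ) × σ => (p.1.1, p.1.2.1, p.2)) primrec_auto
    have h2 : Ar 𝒞 (fun (_ : ι) (p : ℕ × σ × σ) => ∀ t,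
        Encodable.encode t < Encodable.encode p.2.2 → ¬ R p.1 p.2.1 t) := ar_auto h
    exact hR.and h h2
  -- A value is certified by a finite list of the preceding ones, which makes the graph of the
  -- sequence arithmetical.
  have key : Ar 𝒞 (fun (_ : ι) (p : ℕ × σ) => ∃ L : List σ, L[0]? = some s₀ ∧
      L[p.1]? = some p.2 ∧ ∀ i, i < p.1 → ∃ s t, L[i]? = some s ∧ L[i + 1]? = some t ∧
        G i s t) := by
    have h1 : Ar 𝒞 (fun (_ : ι) (p : ((((ℕ × σ) × List σ) × ℕ) × σ) × σ) =>
        G p.1.1.2 p.1.2 p.2) :=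
      hRt.comp h (g := fun p : ((((ℕ × σ) × List σ) × ℕ) × σ) × σ => (p.1.1.2, p.1.2, p.2)) primrec_auto
    exact ar_auto h
  refine key.congr fun _ p => ?_
  obtain ⟨n, s⟩ := p
  dsimp only
  constructor
  · rintro ⟨L, h0, hn, hL⟩
    have : ∀ i ≤ n, L[i]? = some (f i).1 := by
      intro i hi
      induction i with
      | zero => exact h0
      | succ i ih =>
        obtain ⟨s, t, hs, ht, hst⟩ := hL i hi
        rw [ih (by omega), Option.some_inj] at hs
        rw [ht, hGu _ _ _ _ (hf i) (hs ▸ hst)]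
    rw [this n le_rfl, Option.some_inj] at hn
    exact hn
  · rintro rfl
    have hL : ∀ i ≤ n, ((List.range (n + 1)).map fun i => (f i).1)[i]? = some (f i).1 := by
      intro i hi
      rw [List.getElem?_map, List.getElem?_range (by omega)]
      rfl
    exact ⟨_, hL 0 (by omega), hL n le_rfl, fun i hi =>
      ⟨_, _, hL i (by omega), hL (i + 1) (by omega), hf i⟩⟩

end Arithmetic

/-! ### Families of sets of numbers definable over a transitive model -/

section Families

variable {M : Set ZFSet.{u}}

/-- The families of sets of natural numbers that are uniformly definable over `M`. -/
def definableFamilies (h : IsTransitiveZF M) : Set ((ℕ → M) → ℕ → Prop) :=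
  {F | ∃ Q : M → (ℕ → M) → Prop, Def (fun v => Q (v 0) (fun n => v (n + 1))) ∧
    ∀ v n, Q (h.numM n) v ↔ F v n}

/-- The bridge from models to arithmetic: number quantifiers become quantifiers bounded by ω. The
assignment is kept as the index of the family, so a definable set of numbers may depend on sets of
the model. -/
theorem IsTransitiveZF.arithClosed (h : IsTransitiveZF M) : ArithClosed (definableFamilies h) where
  zero := by
    refine ⟨fun x _ => x = h.numM 0, Def.auto, fun v n => ?_⟩
    simp only [IsTransitiveZF.numM, Subtype.mk.injEq, num_inj]
  not := by
    rintro A ⟨Q, dQ, hQ⟩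
    exact ⟨fun x v => ¬ Q x v, dQ.not, fun v n => (hQ v n).not⟩
  and := by
    rintro A B ⟨Q, dQ, hQ⟩ ⟨Q', dQ', hQ'⟩
    exact ⟨fun x v => Q x v ∧ Q' x v, dQ.and dQ', fun v n => and_congr (hQ v n) (hQ' v n)⟩
  preimage := by
    rintro A g ⟨Q, dQ, hQ⟩ hg
    obtain ⟨Qg, dg, hg⟩ := Graph₁.of_primrec h hg
    let o := h.omegaM
    refine ⟨fun x v => ∃ y : M, y.1 ∈ o.1 ∧ (Qg x y ∧ Q y v), ?_, fun v n => ?_⟩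
    · refine Def.ex (Def.and Def.auto (Def.and Def.auto ?_))
      exact dQ.subst (fun i => match i with
        | 0 => fun v => v 0
        | k + 1 => fun v => v (k + 2)) fun i => by cases i <;> exact Tm.var _
    · simp only [o, h.exists_omega, hg, hQ]
      simp
  proj := by
    rintro A ⟨Q, dQ, hQ⟩
    obtain ⟨Qp, dp, hp⟩ := Graph₂.pair h
    let o := h.omegaM
    refine ⟨fun x v => ∃ m : M, m.1 ∈ o.1 ∧ ∃ y : M, y.1 ∈ o.1 ∧ (Qp x m y ∧ Q y v), ?_,
      fun v n => ?_⟩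
    · refine Def.ex (Def.and Def.auto (Def.ex (Def.and Def.auto (Def.and Def.auto ?_))))
      exact dQ.subst (fun i => match i with
        | 0 => fun v => v 0
        | k + 1 => fun v => v (k + 3)) fun i => by cases i <;> exact Tm.var _
    · simp only [o, h.exists_omega, hp, hQ]
      simp

end Families

/-! ### Perfect trees of finite binary sequences -/

section Trees

/-- The `n`-th row of the set `r`, read as a sequence of sets. -/
def row (r : Set ℕ) (n : ℕ) : Set ℕ := {m | Nat.pair n m ∈ r}

/-- The finite sequence `s` is an initial segment of the characteristic function of `x`. -/
def Init (s : List Bool) (x : Set ℕ) : Prop := ∀ i b, s[i]? = some b → (i ∈ x ↔ b = true)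

/-- The initial segment of length `n` of the characteristic function of `x`. -/
noncomputable def seg (x : Set ℕ) (n : ℕ) : List Bool :=
  open scoped Classical in (List.range n).map fun i => decide (i ∈ x)

/-- The real `x` is a branch through `T`. -/
def Branch (T : Set (List Bool)) (x : Set ℕ) : Prop := ∀ s, Init s x → s ∈ T

/-- The sequences `s` and `t` are incompatible. -/
def Incomp (s t : List Bool) : Prop := ¬ s <+: t ∧ ¬ t <+: s

/-- A perfect tree of finite binary sequences. -/
structure IsPTree (T : Set (List Bool)) : Prop where
  down : ∀ s ∈ T, ∀ t, t <+: s → t ∈ T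
  nil_mem : [] ∈ T
  split : ∀ s ∈ T, ∃ t ∈ T, ∃ t' ∈ T, s <+: t ∧ s <+: t' ∧ Incomp t t'

theorem length_seg (x : Set ℕ) (n : ℕ) : (seg x n).length = n := by simp [seg]

theorem init_seg (x : Set ℕ) (n : ℕ) : Init (seg x n) x := by
  intro i b hb
  simp only [seg, List.getElem?_map, Option.map_eq_some_iff] at hb
  obtain ⟨a, ha, rfl⟩ := hb
  obtain ⟨h, rfl⟩ := List.getElem?_eq_some_iff.1 ha
  simp

theorem Init.of_prefix {s t : List Bool} {x : Set ℕ} (ht : Init t x) (h : s <+: t) : Init s x :=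
  fun i b hb => ht i b (by
    obtain ⟨r, rfl⟩ := h
    obtain ⟨h', -⟩ := List.getElem?_eq_some_iff.1 hb
    rwa [List.getElem?_append_left h'])

theorem Init.prefix {s t : List Bool} {x : Set ℕ} (hs : Init s x) (ht : Init t x)
    (h : s.length ≤ t.length) : s <+: t := by
  rw [List.prefix_iff_eq_take]
  apply List.ext_getElem?
  intro i
  by_cases hi : i < s.length
  · rw [List.getElem?_take_of_lt hi, List.getElem?_eq_getElem hi,
      List.getElem?_eq_getElem (hi.trans_le h)]
    have h1 := hs i _ (List.getElem?_eq_getElem hi)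
    have h2 := ht i _ (List.getElem?_eq_getElem (hi.trans_le h))
    rw [Option.some_inj, Bool.eq_iff_iff, ← h1, ← h2]
  · rw [List.getElem?_eq_none (by omega), List.getElem?_eq_none (by simp; omega)]

theorem eq_of_init {x y : Set ℕ} (h : ∀ s, Init s x → Init s y) : x = y := by
  ext i
  have h1 : i < (seg x (i + 1)).length := by rw [length_seg]; exact i.lt_succ_self
  have h2 := List.getElem?_eq_getElem h1
  rw [init_seg x (i + 1) i _ h2, h _ (init_seg x (i + 1)) i _ h2]

theorem IsPTree.exists_not_init {T : Set (List Bool)} (hT : IsPTree T) {s : List Bool}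
    (hs : s ∈ T) (x : Set ℕ) : ∃ t ∈ T, s <+: t ∧ ¬ Init t x := by
  obtain ⟨t, ht, t', ht', hst, hst', h1, h2⟩ := hT.split s hs
  by_cases h : Init t x
  · refine ⟨t', ht', hst', fun h' => ?_⟩
    rcases le_total t.length t'.length with hl | hl
    exacts [h1 (h.prefix h' hl), h2 (h'.prefix h hl)]
  · exact ⟨t, ht, hst, h⟩

/-- The tree that is generated by an increasing sequence of fronts. -/
theorem isPTree_of_nodes {T : Set (List Bool)} (hT : IsPTree T) (N : ℕ → Set (List Bool))
    (hne : (N 0).Nonempty) (hNT : ∀ j, ∀ u ∈ N j, u ∈ T)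
    (hup : ∀ j, ∀ u ∈ N (j + 1), ∃ w ∈ N j, w <+: u)
    (hdown : ∀ j, ∀ w ∈ N j, ∃ u ∈ N (j + 1), w <+: u)
    (hsplit : ∀ j, ∀ w ∈ N j, ∃ k, ∃ u ∈ N k, ∃ u' ∈ N k, w <+: u ∧ w <+: u' ∧ Incomp u u')
    (hbd : ∀ j, ∃ l, ∀ u ∈ N j, u.length ≤ l) :
    IsPTree {s | ∃ j, ∃ u ∈ N j, s <+: u} ∧ {s | ∃ j, ∃ u ∈ N j, s <+: u} ⊆ T ∧
      ∀ x, Branch {s | ∃ j, ∃ u ∈ N j, s <+: u} x → ∀ j, ∃ u ∈ N j, Init u x := by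
  refine ⟨⟨?_, ?_, ?_⟩, ?_, ?_⟩
  · rintro s ⟨j, u, hu, hsu⟩ t hts
    exact ⟨j, u, hu, hts.trans hsu⟩
  · obtain ⟨u, hu⟩ := hne
    exact ⟨0, u, hu, List.nil_prefix⟩
  · rintro s ⟨j, w, hw, hsw⟩
    obtain ⟨k, u, hu, u', hu', h1, h2, h3⟩ := hsplit j w hw
    exact ⟨u, ⟨k, u, hu, List.prefix_rfl⟩, u', ⟨k, u', hu', List.prefix_rfl⟩, hsw.trans h1,
      hsw.trans h2, h3⟩
  · rintro s ⟨j, u, hu, hsu⟩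
    exact hT.down u (hNT j u hu) s hsu
  · intro x hx j
    have hup' : ∀ k, ∀ u ∈ N (j + k), ∃ w ∈ N j, w <+: u := by
      intro k
      induction k with
      | zero => exact fun u hu => ⟨u, hu, List.prefix_rfl⟩
      | succ k ih =>
        intro u hu
        obtain ⟨w, hw, hwu⟩ := hup _ u hu
        obtain ⟨w', hw', hww⟩ := ih w hw
        exact ⟨w', hw', hww.trans hwu⟩
    have hdown' : ∀ k i, ∀ w ∈ N i, ∃ u ∈ N (i + k), w <+: u := by
      intro k i
      induction k with
      | zero => exact fun u hu => ⟨u, hu, List.prefix_rfl⟩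
      | succ k ih =>
        intro u hu
        obtain ⟨w, hw, hwu⟩ := ih u hu
        obtain ⟨w', hw', hww⟩ := hdown _ w hw
        exact ⟨w', hw', hwu.trans hww⟩
    -- An initial segment of x at least as long as all nodes of `N j` extends to a node of a front
    -- beyond stage j. The node of `N j` below that one is then short enough to be an initial
    -- segment of x.
    obtain ⟨l, hl⟩ := hbd j
    obtain ⟨i, u, hu, hiu⟩ := hx (seg x l) (init_seg x l)
    obtain ⟨v, hv, huv⟩ : ∃ v ∈ N (i + j), seg x l <+: v := by
      obtain ⟨v, hv, huv⟩ := hdown' j i u hu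
      exact ⟨v, hv, hiu.trans huv⟩
    rw [add_comm] at hv
    obtain ⟨w, hw, hwv⟩ := hup' i v hv
    refine ⟨w, hw, (init_seg x l).of_prefix ?_⟩
    exact List.prefix_of_prefix_length_le hwv huv (by rw [length_seg]; exact hl w hw)

end Trees

/-- Finite choice without superfluous values: each entry of the new list serves some entry of the
old one. -/
theorem exists_list {α β : Type*} {P : α → β → Prop} (l : List α) (h : ∀ a ∈ l, ∃ b, P a b) :
    ∃ l' : List β, (∀ a ∈ l, ∃ b ∈ l', P a b) ∧ ∀ b ∈ l', ∃ a ∈ l, P a b := by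
  induction l with
  | nil => exact ⟨[], by simp, by simp⟩
  | cons a l ih =>
    obtain ⟨b, hb⟩ := h a (by simp)
    obtain ⟨l', h1, h2⟩ := ih fun c hc => h c (by simp [hc])
    refine ⟨b :: l', ?_, ?_⟩
    · intro c hc
      rcases List.mem_cons.1 hc with rfl | hc
      · exact ⟨b, by simp, hb⟩
      · obtain ⟨d, hd, hcd⟩ := h1 c hc
        exact ⟨d, by simp [hd], hcd⟩
    · intro c hc
      rcases List.mem_cons.1 hc with rfl | hc
      · exact ⟨a, by simp, hb⟩
      · obtain ⟨d, hd, hcd⟩ := h2 c hc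
        exact ⟨d, by simp [hd], hcd⟩

theorem exists_list_bound {α : Type*} (f : α → ℕ) (l : List α) : ∃ N, ∀ a ∈ l, f a ≤ N :=
  ⟨(l.map f).sum, fun _ ha => List.le_sum_of_mem (List.mem_map_of_mem ha)⟩

/-! ### Perfect subtrees avoiding countably many reals -/

section Arithmetic

variable {ι : Type*} {α : Type*} [Primcodable α] {𝒞 : Set (ι → ℕ → Prop)}

theorem Ar.mem_row (h : ArithClosed 𝒞) {r : ι → Set ℕ} (hr : Ar 𝒞 (fun i n => n ∈ r i))
    {f g : α → ℕ} (hf : Primrec f) (hg : Primrec g) :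
    Ar 𝒞 (fun i a => f a ∈ row (r i) (g a)) :=
  Ar.mem h hr (Primrec₂.natPair.comp hg hf)

theorem Ar.init (h : ArithClosed 𝒞) {X : ι → α → Set ℕ}
    (hX : Ar 𝒞 (fun i (p : (α × ℕ) × Bool) => p.1.2 ∈ X i p.1.1))
    {f : α → List Bool} (hf : Primrec f) : Ar 𝒞 (fun i a => Init (f a) (X i a)) := by
  have h1 : Primrec (fun p : (α × ℕ) × Bool => (f p.1.1)[p.1.2]?) :=
    Primrec.list_getElem?.comp (hf.comp primrec_auto) primrec_auto
  have h2 : Ar 𝒞 (fun (_ : ι) (p : (α × ℕ) × Bool) => (f p.1.1)[p.1.2]? = some p.2) :=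
    Ar.eq h h1 primrec_auto
  unfold Init
  exact ar_auto h

theorem Ar.init_row (h : ArithClosed 𝒞) {r : ι → Set ℕ} (hr : Ar 𝒞 (fun i n => n ∈ r i))
    {f : α → List Bool} {g : α → ℕ} (hf : Primrec f) (hg : Primrec g) :
    Ar 𝒞 (fun i a => Init (f a) (row (r i) (g a))) :=
  Ar.init h (Ar.mem_row h hr (f := fun p : (α × ℕ) × Bool => p.1.2) primrec_auto
    (hg.comp (Primrec.fst.comp Primrec.fst))) hf

theorem Ar.init_const (h : ArithClosed 𝒞) {r : ι → Set ℕ} (hr : Ar 𝒞 (fun i n => n ∈ r i))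
    {f : α → List Bool} (hf : Primrec f) : Ar 𝒞 (fun i a => Init (f a) (r i)) :=
  Ar.init h (Ar.mem h hr primrec_auto) hf

/-- A perfect tree has a perfect subtree that avoids a given sequence of reals. -/
theorem exists_ptree_avoiding_rows (h : ArithClosed 𝒞) {T : Set (List Bool)} (hT : IsPTree T)
    (hTA : Ar 𝒞 (fun _ s => s ∈ T)) {Y : Set ℕ} (hY : Ar 𝒞 (fun _ n => n ∈ Y))
    {s : List Bool} (hs : s ∈ T) :
    ∃ S, IsPTree S ∧ S ⊆ T ∧ Ar 𝒞 (fun _ s => s ∈ S) ∧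
      ∀ x, Branch S x → Init s x ∧ ∀ n, x ≠ row Y n := by
  -- Fusion along finite fronts: the nodes of the new front have left row j, and every node of the
  -- old front splits.
  let R : ℕ → List (List Bool) → List (List Bool) → Prop := fun j L L' =>
    (∀ u, u ∈ L' → (u ∈ T ∧ ¬ Init u (row Y j) ∧ ∃ w, w ∈ L ∧ w <+: u)) ∧
    ∀ w, w ∈ L → ∃ u, u ∈ L' ∧ ∃ u', u' ∈ L' ∧ w <+: u ∧ w <+: u' ∧ ¬ u <+: u' ∧ ¬ u' <+: u
  have hR : Ar 𝒞 (fun (_ : ι) (p : ℕ × List (List Bool) × List (List Bool)) =>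
      R p.1 p.2.1 p.2.2) := by
    have h1 : Ar 𝒞 (fun (_ : ι) (p : (ℕ × List (List Bool) × List (List Bool)) × List Bool) =>
      Init p.2 (row Y p.1.1)) := Ar.init_row h hY primrec_auto primrec_auto
    exact ar_auto h
  obtain ⟨st, h0, hst, hA⟩ := exists_sequence h hR (fun _ L => ∀ u ∈ L, u ∈ T) [s]
    (by simpa using hs) (by
      intro j L hL
      obtain ⟨L', h1, h2⟩ := exists_list (P := fun w (q : List Bool × List Bool) =>
        (q.1 ∈ T ∧ ¬ Init q.1 (row Y j) ∧ w <+: q.1) ∧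
        (q.2 ∈ T ∧ ¬ Init q.2 (row Y j) ∧ w <+: q.2) ∧ Incomp q.1 q.2) L (by
          intro w hw
          obtain ⟨t, ht, hwt, hn⟩ := hT.exists_not_init (hL w hw) (row Y j)
          obtain ⟨u, hu, u', hu', h1, h2, h3⟩ := hT.split t ht
          exact ⟨(u, u'), ⟨hu, fun h' => hn (h'.of_prefix h1), hwt.trans h1⟩,
            ⟨hu', fun h' => hn (h'.of_prefix h2), hwt.trans h2⟩, h3⟩)
      refine ⟨L'.flatMap fun q => [q.1, q.2], ?_, ?_⟩
      · intro u hu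
        obtain ⟨q, hq, hu⟩ := List.mem_flatMap.1 hu
        obtain ⟨w, hw, ha, hb, -⟩ := h2 q hq
        simp only [List.mem_cons, List.not_mem_nil, or_false] at hu
        rcases hu with rfl | rfl
        exacts [⟨ha.1, ha.2.1, w, hw, ha.2.2⟩, ⟨hb.1, hb.2.1, w, hw, hb.2.2⟩]
      · intro w hw
        obtain ⟨q, hq, ha, hb, hc⟩ := h1 w hw
        exact ⟨q.1, List.mem_flatMap.2 ⟨q, hq, by simp⟩, q.2, List.mem_flatMap.2 ⟨q, hq, by simp⟩,
          ha.2.2, hb.2.2, hc.1, hc.2⟩)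
    (fun j L L' _ hR u hu => (hR.1 u hu).1)
  have hTst : ∀ j, ∀ u ∈ st j, u ∈ T := by
    intro j
    cases j with
    | zero => rw [h0]; simpa using hs
    | succ j => exact fun u hu => ((hst j).1 u hu).1
  obtain ⟨h1, h2, h3⟩ := isPTree_of_nodes hT (fun j => {u | u ∈ st j})
    ⟨s, by simp [h0]⟩ hTst (fun j u hu => ((hst j).1 u hu).2.2)
    (fun j w hw => by
      obtain ⟨u, hu, -, -, hwu, -⟩ := (hst j).2 w hw
      exact ⟨u, hu, hwu⟩)
    (fun j w hw => by
      obtain ⟨u, hu, u', hu', h1, h2, h3⟩ := (hst j).2 w hw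
      exact ⟨j + 1, u, hu, u', hu', h1, h2, h3⟩)
    (fun j => exists_list_bound _ _)
  refine ⟨_, h1, h2, ?_, fun x hx => ⟨?_, fun n e => ?_⟩⟩
  · have : Ar 𝒞 (fun (_ : ι) (s : List Bool) => ∃ j : ℕ, ∃ L, st j = L ∧ ∃ u, u ∈ L ∧ s <+: u) := by
      have h1 : Ar 𝒞 (fun (_ : ι) (p : (List Bool × ℕ) × List (List Bool)) => st p.1.2 = p.2) :=
        hA.comp h (g := fun p : (List Bool × ℕ) × List (List Bool) => (p.1.2, p.2)) primrec_auto
      exact ar_auto h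
    refine this.congr fun _ s => ?_
    simp
  · obtain ⟨u, hu, hux⟩ := h3 x hx 0
    have hu : u = s := by simpa [h0] using hu
    exact hu ▸ hux
  · obtain ⟨u, hu, hux⟩ := h3 x hx (n + 1)
    exact ((hst n).1 u hu).2.1 (e ▸ hux)

end Arithmetic

/-! ### Coding a real into pairs of branches -/

section Coding

variable {T : Set (List Bool)} {X Par : Set ℕ}

/-- Some initial segment of `x` agrees with one of the first `n + 1` rows of `X` for longer than `y`
agrees with any of them. -/
def Leads (X x y : Set ℕ) (n : ℕ) : Prop :=
  ∃ w, Init w x ∧ (∃ k, k ≤ n ∧ Init w (row X k)) ∧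
    ∀ i, i ≤ n → ∃ w', Init w' y ∧ w'.length ≤ w.length ∧ ¬ Init w' (row X i)

/-- If both sides led, the longer of the two witnesses would still agree with a row that, by the
lead of the other side, has been left earlier. -/
theorem Leads.not_symm {x y : Set ℕ} {n : ℕ} (h : Leads X x y n) : ¬ Leads X y x n := by
  rintro ⟨w₂, hw₂, ⟨k₂, hk₂, hX₂⟩, h₂⟩
  obtain ⟨w₁, hw₁, ⟨k₁, hk₁, hX₁⟩, h₁⟩ := h
  rcases le_total w₁.length w₂.length with hl | hl
  · obtain ⟨w', h, hl', hn⟩ := h₁ k₂ hk₂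
    exact hn (hX₂.of_prefix (h.prefix hw₂ (hl'.trans hl)))
  · obtain ⟨w', h, hl', hn⟩ := h₂ k₁ hk₁
    exact hn (hX₁.of_prefix (h.prefix hw₁ (hl'.trans hl)))

/-- Every node of `T` lies on a row of `X` that is a branch through `T`, both with the index in
`Par` and with the index not in `Par`. -/
def DenseRows (T : Set (List Bool)) (X Par : Set ℕ) : Prop :=
  ∀ s ∈ T, ∀ b : Prop, ∃ m, Init s (row X m) ∧ Branch T (row X m) ∧ (m ∈ Par ↔ b)

/-- The node `q.1` of `T` lies on the `q.2`-th row of `X`, a branch through `T`, but on no earlier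
row, and `Par q.2` has the given truth value. -/
def Target (T : Set (List Bool)) (X Par : Set ℕ) (b : Prop) (q : List Bool × ℕ) : Prop :=
  q.1 ∈ T ∧ Init q.1 (row X q.2) ∧ (∀ s, Init s (row X q.2) → s ∈ T) ∧ (q.2 ∈ Par ↔ b) ∧
    ∀ i, i < q.2 → ¬ Init q.1 (row X i)

/-- Splitting leaves rows 0, ..., N one by one, and density gives a row of the required colour
through the node reached. The colour depends only on the row as a set, so the least index of that
row may be used; all earlier rows then differ from it, and a long enough initial segment excludes
them. -/
theorem exists_target (hT : IsPTree T) (hd : DenseRows T X Par)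
    (hPar : ∀ m m', row X m = row X m' → (m ∈ Par ↔ m' ∈ Par)) {s : List Bool} (hs : s ∈ T)
    (b : Prop) (N : ℕ) : ∃ q, s <+: q.1 ∧ N < q.2 ∧ Target T X Par b q := by
  classical
  have h1 : ∀ N : ℕ, ∃ t ∈ T, s <+: t ∧ ∀ i < N, ¬ Init t (row X i) := by
    intro N
    induction N with
    | zero => exact ⟨s, hs, List.prefix_rfl, by simp⟩
    | succ N ih =>
      obtain ⟨t, ht, hst, h⟩ := ih
      obtain ⟨t', ht', htt, hn⟩ := hT.exists_not_init ht (row X N)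
      refine ⟨t', ht', hst.trans htt, fun i hi hI => ?_⟩
      rcases Nat.lt_succ_iff_lt_or_eq.1 hi with hi | rfl
      exacts [h i hi (hI.of_prefix htt), hn hI]
  obtain ⟨t, ht, hst, hn⟩ := h1 (N + 1)
  obtain ⟨m₀, hm₀, hB, hb⟩ := hd t ht b
  have hex : ∃ m, row X m = row X m₀ := ⟨m₀, rfl⟩
  set m := Nat.find hex with hm
  have e : row X m = row X m₀ := Nat.find_spec hex
  have hmin : ∀ i < m, row X i ≠ row X m := fun i hi h => Nat.find_min hex hi (h.trans e)
  have h2 : ∀ k : ℕ, ∃ l, ∀ i < k, i < m → ¬ Init (seg (row X m) l) (row X i) := by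
    intro k
    induction k with
    | zero => exact ⟨0, by simp⟩
    | succ k ih =>
      obtain ⟨l, hl⟩ := ih
      by_cases hk : k < m
      · have : ∃ w, Init w (row X m) ∧ ¬ Init w (row X k) := by
          by_contra hc
          push Not at hc
          exact hmin k hk (eq_of_init hc).symm
        obtain ⟨w, hw, hwk⟩ := this
        refine ⟨max l w.length, fun i hi him hI => ?_⟩
        rcases Nat.lt_succ_iff_lt_or_eq.1 hi with hi | rfl
        · refine hl i hi him (hI.of_prefix ((init_seg _ _).prefix (init_seg _ _) ?_))
          simp [length_seg]
        · refine hwk (hI.of_prefix (hw.prefix (init_seg _ _) ?_))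
          simp [length_seg]
      · refine ⟨l, fun i hi him hI => ?_⟩
        exact hl i (by omega) him hI
  obtain ⟨l, hl⟩ := h2 m
  have hI : ∀ k, Init (seg (row X m) k) (row X m) := init_seg _
  have htm : Init t (row X m) := e ▸ hm₀
  refine ⟨(seg (row X m) (max l t.length), m), ?_, ?_, ?_, ?_, ?_, ?_, ?_⟩
  · exact hst.trans (htm.prefix (hI _) (by simp [length_seg]))
  · by_contra hc
    exact hn m (by simp only at hc; omega) htm
  · exact hB _ (e ▸ hI _)
  · exact hI _
  · intro s hs
    exact hB s (e ▸ hs)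
  · exact (hPar _ _ e).trans hb
  · intro i hi h
    exact hl i hi hi (h.of_prefix ((hI _).prefix (hI _) (by simp [length_seg])))

/-- One step of the construction: the passive nodes `st.2` become active nodes with targets, while
the active nodes `st.1` follow their targets, split, and become passive. -/
def Step (T : Set (List Bool)) (X Par : Set ℕ) (b : Prop)
    (st st' : List (List Bool × ℕ) × List (List Bool)) : Prop :=
  (∀ q, q ∈ st'.1 → ((∃ z, z ∈ st.2 ∧ z <+: q.1) ∧ Target T X Par b q ∧
    ∀ p, p ∈ st.1 → p.2 < q.2)) ∧
  (∀ z, z ∈ st.2 → ∃ q, q ∈ st'.1 ∧ z <+: q.1) ∧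
  (∀ u, u ∈ st'.2 → (u ∈ T ∧ ∃ p, p ∈ st.1 ∧ p.1 <+: u ∧ ∃ w, w <+: u ∧ Init w (row X p.2) ∧
    ∀ q, q ∈ st'.1 → q.1.length ≤ w.length)) ∧
  ∀ p, p ∈ st.1 → ∃ u, u ∈ st'.2 ∧ ∃ u', u' ∈ st'.2 ∧ p.1 <+: u ∧ p.1 <+: u' ∧
    ¬ u <+: u' ∧ ¬ u' <+: u

/-- The order of choices matters: the new targets come first, with indices above all old ones. The
maximal length l of their nodes then tells how far the active nodes must follow their rows before
they split. -/
theorem exists_step (hT : IsPTree T) (hd : DenseRows T X Par)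
    (hPar : ∀ m m', row X m = row X m' → (m ∈ Par ↔ m' ∈ Par)) (b b' : Prop)
    (st : List (List Bool × ℕ) × List (List Bool)) (h₁ : ∀ q ∈ st.1, Target T X Par b q)
    (h₂ : ∀ z ∈ st.2, z ∈ T) : ∃ st', Step T X Par b' st st' := by
  obtain ⟨N, hN⟩ := exists_list_bound (fun q : List Bool × ℕ => q.2) st.1
  obtain ⟨A, hA, hA'⟩ := exists_list st.2 fun z hz => exists_target hT hd hPar (h₂ z hz) b' N
  obtain ⟨l, hl⟩ := exists_list_bound (fun q : List Bool × ℕ => q.1.length) A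
  obtain ⟨Z, hZ, hZ'⟩ := exists_list (P := fun (p : List Bool × ℕ) (q : List Bool × List Bool) =>
    q.1 ∈ T ∧ q.2 ∈ T ∧ Incomp q.1 q.2 ∧ p.1 <+: q.1 ∧ p.1 <+: q.2 ∧
      seg (row X p.2) l <+: q.1 ∧ seg (row X p.2) l <+: q.2) st.1 (by
        intro p hp
        obtain ⟨-, hi, hB, -⟩ := h₁ p hp
        have hI := init_seg (row X p.2)
        obtain ⟨t, ht, t', ht', h1, h2, h3⟩ := hT.split _ (hB _ (hI (max l p.1.length)))
        have h4 : p.1 <+: seg (row X p.2) (max l p.1.length) :=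
          hi.prefix (hI _) (by simp [length_seg])
        have h5 : seg (row X p.2) l <+: seg (row X p.2) (max l p.1.length) :=
          (hI _).prefix (hI _) (by simp [length_seg])
        exact ⟨(t, t'), ht, ht', h3, h4.trans h1, h4.trans h2, h5.trans h1, h5.trans h2⟩)
  refine ⟨(A, Z.flatMap fun q => [q.1, q.2]), ?_, ?_, ?_, ?_⟩
  · intro q hq
    obtain ⟨z, hz, hzq, hlt, ht⟩ := hA' q hq
    exact ⟨⟨z, hz, hzq⟩, ht, fun p hp => (hN p hp).trans_lt hlt⟩
  · intro z hz
    obtain ⟨q, hq, hzq, -⟩ := hA z hz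
    exact ⟨q, hq, hzq⟩
  · intro u hu
    obtain ⟨q, hq, hu⟩ := List.mem_flatMap.1 hu
    obtain ⟨p, hp, h1, h2, -, h4, h5, h6, h7⟩ := hZ' q hq
    have hlen : ∀ q, q ∈ A → q.1.length ≤ (seg (row X p.2) l).length := by
      intro q hq
      rw [length_seg]
      exact hl q hq
    simp only [List.mem_cons, List.not_mem_nil, or_false] at hu
    rcases hu with rfl | rfl
    exacts [⟨h1, p, hp, h4, _, h6, init_seg _ _, hlen⟩, ⟨h2, p, hp, h5, _, h7, init_seg _ _, hlen⟩]
  · intro p hp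
    obtain ⟨q, hq, -, -, h3, h4, h5, -⟩ := hZ p hp
    exact ⟨q.1, List.mem_flatMap.2 ⟨q, hq, by simp⟩, q.2, List.mem_flatMap.2 ⟨q, hq, by simp⟩,
      h4, h5, h3.1, h3.2⟩

variable {ι : Type*} {κ : Type*} {𝒱 : Set (ι → ℕ → Prop)} {𝒲 : Set (κ → ℕ → Prop)}

theorem ar_step (h : ArithClosed 𝒱) (hT : Ar 𝒱 (fun _ s => s ∈ T)) (hX : Ar 𝒱 (fun _ n => n ∈ X))
    (hPar : Ar 𝒱 (fun _ n => n ∈ Par)) {c : Set ℕ} (hc : Ar 𝒱 (fun _ n => n ∈ c)) :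
    Ar 𝒱 (fun _ (p : ℕ × (List (List Bool × ℕ) × List (List Bool)) ×
      (List (List Bool × ℕ) × List (List Bool))) => Step T X Par (p.1 + 1 ∈ c) p.2.1 p.2.2) := by
  have h4 : Ar 𝒱 (fun _ (p : (List Bool × ℕ) × ℕ) => Target T X Par (p.2 + 1 ∈ c) p.1) := by
    have h2' : Ar 𝒱 (fun _ (p : ((List Bool × ℕ) × ℕ) × ℕ) => Init p.1.1.1 (row X p.2)) :=
      Ar.init_row h hX primrec_auto primrec_auto
    have h3' : Ar 𝒱 (fun _ (p : ((List Bool × ℕ) × ℕ) × List Bool) =>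
      Init p.2 (row X p.1.1.2)) := Ar.init_row h hX primrec_auto primrec_auto
    have h1' : Ar 𝒱 (fun _ (p : (List Bool × ℕ) × ℕ) => Init p.1.1 (row X p.1.2)) :=
      Ar.init_row h hX primrec_auto primrec_auto
    unfold Target
    exact ar_auto h
  have h5 : Ar 𝒱 (fun _ (p : (ℕ × (List (List Bool × ℕ) × List (List Bool)) ×
      (List (List Bool × ℕ) × List (List Bool))) × (List Bool × ℕ)) =>
      Target T X Par (p.1.1 + 1 ∈ c) p.2) :=
    h4.comp h (g := fun p : (ℕ × (List (List Bool × ℕ) × List (List Bool)) ×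
      (List (List Bool × ℕ) × List (List Bool))) × (List Bool × ℕ) => (p.2, p.1.1)) primrec_auto
  have h6 : Ar 𝒱 (fun _ (p : (((ℕ × (List (List Bool × ℕ) × List (List Bool)) ×
      (List (List Bool × ℕ) × List (List Bool))) × List Bool) × (List Bool × ℕ)) × List Bool) =>
      Init p.2 (row X p.1.2.2)) := Ar.init_row h hX primrec_auto primrec_auto
  unfold Step
  exact ar_auto h

theorem ar_leads (h : ArithClosed 𝒲) (hX : Ar 𝒲 (fun _ n => n ∈ X)) {x y : Set ℕ}
    (hx : Ar 𝒲 (fun _ n => n ∈ x)) (hy : Ar 𝒲 (fun _ n => n ∈ y)) :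
    Ar 𝒲 (fun _ n => Leads X x y n) := by
  have h1 : Ar 𝒲 (fun _ (p : ℕ × List Bool) => Init p.2 x) := Ar.init_const h hx primrec_auto
  have h2 : Ar 𝒲 (fun _ (p : (ℕ × List Bool) × ℕ) => Init p.1.2 (row X p.2)) :=
    Ar.init_row h hX primrec_auto primrec_auto
  have h3 : Ar 𝒲 (fun _ (p : ((ℕ × List Bool) × ℕ) × List Bool) => Init p.2 y) :=
    Ar.init_const h hy primrec_auto
  have h4 : Ar 𝒲 (fun _ (p : ((ℕ × List Bool) × ℕ) × List Bool) => Init p.2 (row X p.1.2)) :=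
    Ar.init_row h hX primrec_auto primrec_auto
  unfold Leads
  exact ar_auto h

/-- If the truth value of `Leads X x y` alternates at the increasing sequence `t`, then every
collection that contains `X`, `x` and `y` contains the preimage of `Par` under `t`. -/
theorem ar_decode (h : ArithClosed 𝒲) (hX : Ar 𝒲 (fun _ n => n ∈ X))
    (hPar : Ar 𝒲 (fun _ n => n ∈ Par)) {x y : Set ℕ}
    (hx : Ar 𝒲 (fun _ n => n ∈ x)) (hy : Ar 𝒲 (fun _ n => n ∈ y)) {t : ℕ → ℕ}
    (ht : ∀ j, t j < t (j + 1))
    (hL : ∀ j n, t j ≤ n → n < t (j + 1) → (Leads X x y n ↔ j.bodd = false)) :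
    Ar 𝒲 (fun _ j => t j ∈ Par) := by
  -- The first index after s at which the lead has changed. It is unique, so iterating from `t 0`
  -- reproduces t.
  let R : ℕ → ℕ → ℕ → Prop := fun _ s s' => s < s' ∧ ¬ (Leads X x y s' ↔ Leads X x y s) ∧
    ∀ n, s ≤ n → n < s' → (Leads X x y n ↔ Leads X x y s)
  have hl := ar_leads h hX hx hy
  have hR : Ar 𝒲 (fun _ (p : ℕ × ℕ × ℕ) => R p.1 p.2.1 p.2.2) := by
    have h1 : Ar 𝒲 (fun _ (p : ℕ × ℕ × ℕ) => Leads X x y p.2.1) := hl.comp h primrec_auto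
    have h2 : Ar 𝒲 (fun _ (p : ℕ × ℕ × ℕ) => Leads X x y p.2.2) := hl.comp h primrec_auto
    have h3 : Ar 𝒲 (fun _ (p : (ℕ × ℕ × ℕ) × ℕ) => Leads X x y p.2) := hl.comp h primrec_auto
    have h4 : Ar 𝒲 (fun _ (p : (ℕ × ℕ × ℕ) × ℕ) => Leads X x y p.1.2.1) :=
      hl.comp h primrec_auto
    exact ar_auto h
  have hRt : ∀ j, R j (t j) (t (j + 1)) := by
    intro j
    refine ⟨ht j, ?_, fun n hn hn' => ?_⟩
    · rw [hL j _ le_rfl (ht j), hL (j + 1) _ le_rfl (ht (j + 1)), Nat.bodd_succ]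
      cases j.bodd <;> simp
    · rw [hL j _ hn hn', hL j _ le_rfl (ht j)]
  have hRu : ∀ j s s₁ s₂, R j s s₁ → R j s s₂ → ¬ s₁ < s₂ := fun j s s₁ s₂ h1 h2 hlt =>
    h1.2.1 (h2.2.2 s₁ h1.1.le hlt)
  obtain ⟨st, h0, hst, hA⟩ := exists_sequence h hR (fun j s => s = t j) (t 0) rfl
    (fun j s hs => ⟨t (j + 1), hs ▸ hRt j⟩) (fun j s s' hs hR => by
      subst hs
      have h1 := hRu j _ _ _ hR (hRt j)
      have h2 := hRu j _ _ _ (hRt j) hR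
      omega)
  have hst' : ∀ j, st j = t j := by
    intro j
    induction j with
    | zero => exact h0
    | succ j ih =>
      have h1 := hst j
      rw [ih] at h1
      have h2 := hRu j _ _ _ h1 (hRt j)
      have h3 := hRu j _ _ _ (hRt j) h1
      omega
  have : Ar 𝒲 (fun _ (j : ℕ) => ∃ m, st j = m ∧ m ∈ Par) := ar_auto h
  exact this.congr fun _ j => by simp [hst']

/-- If `c` belongs to `𝒱` but not to `𝒲`, and `T` has dense sets of branches enumerated in `𝒲`,
then some perfect subtree of `T` in `𝒱` has no branch in `𝒲`. -/
theorem exists_ptree_avoiding (hV : ArithClosed 𝒱) (hW : ArithClosed 𝒲) (hT : IsPTree T)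
    (hTA : Ar 𝒱 (fun _ s => s ∈ T)) (hX : Ar 𝒱 (fun _ n => n ∈ X))
    (hPar : Ar 𝒱 (fun _ n => n ∈ Par)) (hXW : Ar 𝒲 (fun _ n => n ∈ X))
    (hParW : Ar 𝒲 (fun _ n => n ∈ Par)) (hd : DenseRows T X Par)
    (hPX : ∀ m m', row X m = row X m' → (m ∈ Par ↔ m' ∈ Par)) {c : Set ℕ}
    (hc : Ar 𝒱 (fun _ n => n ∈ c)) (hcW : ¬ Ar 𝒲 (fun _ n => n ∈ c)) :
    ∃ S, IsPTree S ∧ S ⊆ T ∧ Ar 𝒱 (fun _ s => s ∈ S) ∧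
      ∀ x, Branch S x → ¬ Ar 𝒲 (fun _ n => n ∈ x) := by
  -- At stage 0 the tree `false` is active, with a target coloured by bit 0 of c, and the tree
  -- `true` waits at its root.
  obtain ⟨q₀, -, -, hq₀⟩ := exists_target hT hd hPX hT.nil_mem (0 ∈ c) 0
  obtain ⟨st, h0, hst, hA⟩ := exists_sequence hV (ar_step hV hTA hX hPar hc)
    (fun j st => (∀ q ∈ st.1, Target T X Par (j ∈ c) q) ∧ ∀ z ∈ st.2, z ∈ T) ([q₀], [[]])
    (by simpa using ⟨hq₀, hT.nil_mem⟩)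
    (fun j st h => exists_step hT hd hPX _ _ st h.1 h.2)
    (fun j st st' _ h => ⟨fun q hq => (h.1 q hq).2.1, fun z hz => (h.2.2.1 z hz).1⟩)
  have hinv : ∀ j, (∀ q ∈ (st j).1, Target T X Par (j ∈ c) q) ∧ ∀ z ∈ (st j).2, z ∈ T := by
    intro j
    cases j with
    | zero => rw [h0]; simpa using ⟨hq₀, hT.nil_mem⟩
    | succ j => exact ⟨fun q hq => ((hst j).1 q hq).2.1, fun z hz => ((hst j).2.2.1 z hz).1⟩
  -- Both trees live in one state: tree `e` owns the active nodes at stages of parity `e` and the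
  -- passive nodes at the other stages.
  let N : Bool → ℕ → Set (List Bool) := fun e j => {s |
    (j.bodd = e ∧ ∃ q, q ∈ (st j).1 ∧ q.1 = s) ∨ (¬ j.bodd = e ∧ s ∈ (st j).2)}
  have hsucc : ∀ (j : ℕ) (e : Bool), (j + 1).bodd = e ↔ ¬ j.bodd = e := by
    intro j e
    rw [Nat.bodd_succ]
    cases j.bodd <;> cases e <;> simp
  have hdown : ∀ e j, ∀ w ∈ N e j, ∃ u ∈ N e (j + 1), w <+: u := by
    rintro e j w (⟨hj, q, hq, rfl⟩ | ⟨hj, hw⟩)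
    · obtain ⟨u, hu, -, -, hqu, -⟩ := (hst j).2.2.2 q hq
      exact ⟨u, Or.inr ⟨by rw [hsucc]; simpa using hj, hu⟩, hqu⟩
    · obtain ⟨q, hq, hwq⟩ := (hst j).2.1 w hw
      exact ⟨q.1, Or.inl ⟨by rwa [hsucc], q, hq, rfl⟩, hwq⟩
  have hsplit : ∀ e j, ∀ w ∈ N e j, j.bodd = e →
      ∃ u ∈ N e (j + 1), ∃ u' ∈ N e (j + 1), w <+: u ∧ w <+: u' ∧ Incomp u u' := by
    rintro e j w (⟨hj, q, hq, rfl⟩ | ⟨hj, hw⟩) he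
    · obtain ⟨u, hu, u', hu', h1, h2, h3⟩ := (hst j).2.2.2 q hq
      have hj' : ¬ (j + 1).bodd = e := by rw [hsucc]; simpa using hj
      exact ⟨u, Or.inr ⟨hj', hu⟩, u', Or.inr ⟨hj', hu'⟩, h1, h2, h3⟩
    · exact absurd he hj
  have hnodes := fun e => isPTree_of_nodes hT (N e)
    (by
      cases e with
      | false => exact ⟨q₀.1, Or.inl ⟨rfl, q₀, by simp [h0], rfl⟩⟩
      | true => exact ⟨[], Or.inr ⟨by simp, by simp [h0]⟩⟩)
    (by
      rintro j u (⟨-, q, hq, rfl⟩ | ⟨-, hu⟩)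
      exacts [((hinv j).1 q hq).1, (hinv j).2 u hu])
    (by
      rintro j u (⟨hj, q, hq, rfl⟩ | ⟨hj, hu⟩)
      · obtain ⟨⟨z, hz, hzq⟩, -⟩ := (hst j).1 q hq
        exact ⟨z, Or.inr ⟨by rwa [← hsucc], hz⟩, hzq⟩
      · obtain ⟨-, p, hp, hpu, -⟩ := (hst j).2.2.1 u hu
        exact ⟨p.1, Or.inl ⟨by rw [hsucc] at hj; simpa using hj, p, hp, rfl⟩, hpu⟩)
    (hdown e)
    (by
      intro j w hw
      by_cases hj : j.bodd = e
      · obtain ⟨u, hu, u', hu', h⟩ := hsplit e j w hw hj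
        exact ⟨j + 1, u, hu, u', hu', h⟩
      · obtain ⟨v, hv, hwv⟩ := hdown e j w hw
        obtain ⟨u, hu, u', hu', h1, h2, h3⟩ := hsplit e (j + 1) v hv (by rwa [hsucc])
        exact ⟨j + 1 + 1, u, hu, u', hu', hwv.trans h1, hwv.trans h2, h3⟩)
    (by
      intro j
      obtain ⟨l, hl⟩ := exists_list_bound (fun q : List Bool × ℕ => q.1.length) (st j).1
      obtain ⟨l', hl'⟩ := exists_list_bound (fun s : List Bool => s.length) (st j).2
      refine ⟨max l l', ?_⟩
      rintro u (⟨-, q, hq, rfl⟩ | ⟨-, hu⟩)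
      exacts [le_max_of_le_left (hl q hq), le_max_of_le_right (hl' u hu)])
  have hArN : ∀ e, Ar 𝒱 (fun _ s => s ∈ {s | ∃ j, ∃ u ∈ N e j, s <+: u}) := by
    intro e
    have h1 : Ar 𝒱 (fun _ (p : (List Bool × ℕ) × (List (List Bool × ℕ) × List (List Bool))) =>
        st p.1.2 = p.2) :=
      hA.comp hV (g := fun p : (List Bool × ℕ) × (List (List Bool × ℕ) × List (List Bool)) =>
        (p.1.2, p.2)) primrec_auto
    have h2 : Ar 𝒱 (fun _ (p : ((List Bool × ℕ) ×
        (List (List Bool × ℕ) × List (List Bool))) × List Bool) => p.1.1.2.bodd = e) :=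
      Ar.eq hV (Primrec.nat_bodd.comp primrec_auto) primrec_auto
    have : Ar 𝒱 (fun _ (s : List Bool) => ∃ j : ℕ, ∃ σ, st j = σ ∧ ∃ u : List Bool,
        ((j.bodd = e ∧ ∃ q, q ∈ σ.1 ∧ q.1 = u) ∨ (¬ j.bodd = e ∧ u ∈ σ.2)) ∧ s <+: u) :=
      ar_auto hV
    exact this.congr fun _ s => ⟨fun ⟨j, _, rfl, u, hu⟩ => ⟨j, u, hu⟩,
      fun ⟨j, u, hu⟩ => ⟨j, _, rfl, u, hu⟩⟩
  -- If neither tree works, each has a branch in 𝒲, and these two branches will decode c.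
  by_contra hcon
  push Not at hcon
  have hbr : ∀ e, ∃ x, Ar 𝒲 (fun _ n => n ∈ x) ∧ ∀ j, ∃ u ∈ N e j, Init u x := by
    intro e
    obtain ⟨x, hx, hxW⟩ := hcon _ (hnodes e).1 (hnodes e).2.1 (hArN e)
    exact ⟨x, hxW, (hnodes e).2.2 x hx⟩
  choose a haW ha using hbr
  -- The branch of the tree active at stage j is inspected at stage j + 1, when it is passive and
  -- has followed the row of its target p along w.
  have hp : ∀ j : ℕ, ∃ p ∈ (st j).1, Init p.1 (a j.bodd) ∧ ∃ w, Init w (a j.bodd) ∧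
      Init w (row X p.2) ∧ ∀ q, q ∈ (st (j + 1)).1 → q.1.length ≤ w.length := by
    intro j
    obtain ⟨u, hu | hu, hua⟩ := ha j.bodd (j + 1)
    · exact absurd rfl ((hsucc _ _).1 hu.1)
    · obtain ⟨-, p, hp, hpu, w, hwu, hw, hlen⟩ := (hst j).2.2.1 u hu.2
      exact ⟨p, hp, hua.of_prefix hpu, w, hua.of_prefix hwu, hw, hlen⟩
  choose p hp hpa w hwa hwX hlen using hp
  have ht : ∀ j, (p j).2 < (p (j + 1)).2 := fun j => ((hst j).1 _ (hp (j + 1))).2.2 _ (hp j)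
  -- The segment `w j` is at least as long as the next node on the other side, and that node lies on
  -- no row before its own target.
  have hleads : ∀ j n, (p j).2 ≤ n → n < (p (j + 1)).2 →
      Leads X (a j.bodd) (a (j + 1).bodd) n := by
    intro j n hn hn'
    refine ⟨w j, hwa j, ⟨_, hn, hwX j⟩, fun i hi => ⟨(p (j + 1)).1, hpa (j + 1),
      hlen j _ (hp (j + 1)), ?_⟩⟩
    exact ((hinv (j + 1)).1 _ (hp (j + 1))).2.2.2.2 i (hi.trans_lt hn')
  have := ar_decode hW hXW hParW (haW false) (haW true) ht (by
    intro j n hn hn'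
    have := hleads j n hn hn'
    rw [Nat.bodd_succ] at this
    -- At odd j the branch `a true` leads, which excludes a lead of `a false`.
    cases hj : j.bodd with
    | false =>
      rw [hj] at this
      simpa using this
    | true =>
      rw [hj] at this
      simpa using this.not_symm)
  refine hcW (this.congr fun _ j => ?_)
  exact ((hinv j).1 _ (hp j)).2.2.2.1

end Coding

/-! ### Partial functions from `ω` to `2` as sets -/

section Graphs

/-- The truth value `b` as an element of `2`. -/
noncomputable def bit (b : Bool) : ZFSet.{u} := num (if b then 1 else 0)

theorem bit_injective : Function.Injective bit.{u} := by
  intro a b h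
  have := num_injective h
  cases a <;> cases b <;> simp_all

theorem mem_two {x : ZFSet.{u}} : x ∈ two ↔ ∃ b, x = bit b := by
  rw [two_eq, mem_num]
  constructor
  · rintro ⟨m, hm, rfl⟩
    interval_cases m
    exacts [⟨false, rfl⟩, ⟨true, rfl⟩]
  · rintro ⟨b, rfl⟩
    cases b
    exacts [⟨0, by simp, rfl⟩, ⟨1, by simp, rfl⟩]

/-- The graph of a partial function from `ω` to `2`. -/
noncomputable def graph (p : ℕ → Option Bool) : ZFSet.{u} :=
  ZFSet.sep (fun z => ∃ i b, p i = some b ∧ z = ZFSet.pair (num i) (bit b))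
    (ZFSet.prod ZFSet.omega two)

theorem mem_graph {p : ℕ → Option Bool} {z : ZFSet.{u}} :
    z ∈ graph p ↔ ∃ i b, p i = some b ∧ z = ZFSet.pair (num i) (bit b) := by
  rw [graph, ZFSet.mem_sep]
  refine and_iff_right_of_imp ?_
  rintro ⟨i, b, -, rfl⟩
  exact ZFSet.pair_mem_prod.2 ⟨num_mem_omega i, mem_two.2 ⟨b, rfl⟩⟩

theorem pair_mem_graph {p : ℕ → Option Bool} {i : ℕ} {b : Bool} :
    ZFSet.pair (num.{u} i) (bit b) ∈ graph p ↔ p i = some b := by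
  rw [mem_graph]
  constructor
  · rintro ⟨j, c, h, e⟩
    obtain ⟨h1, h2⟩ := ZFSet.pair_injective e
    rw [num_injective h1, bit_injective h2, h]
  · exact fun h => ⟨i, b, h, rfl⟩

theorem graph_subset {p q : ℕ → Option Bool} :
    graph.{u} p ⊆ graph q ↔ ∀ i b, p i = some b → q i = some b := by
  constructor
  · intro h i b hp
    exact pair_mem_graph.1 (h (pair_mem_graph.2 hp))
  · intro h z hz
    obtain ⟨i, b, hp, rfl⟩ := mem_graph.1 hz
    exact pair_mem_graph.2 (h i b hp)

theorem graph_injective : Function.Injective graph.{u} := by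
  intro p q h
  funext i
  have h1 := graph_subset.1 (show graph p ⊆ graph q from h ▸ fun _ hz => hz) i
  have h2 := graph_subset.1 (show graph q ⊆ graph p from h ▸ fun _ hz => hz) i
  cases hp : p i with
  | some b => exact (h1 b hp).symm
  | none =>
    cases hq : q i with
    | none => rfl
    | some b => rw [h2 b hq] at hp; exact absurd hp (by simp)

theorem isFunc_graph {D : ZFSet.{u}} {p : ℕ → Option Bool} (hD : ∀ z ∈ D, z ∈ ZFSet.omega)
    (hp : ∀ i, num i ∈ D ↔ ∃ b, p i = some b) : ZFSet.IsFunc D two (graph p) := by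
  refine ⟨fun z hz => ?_, fun z hz => ?_⟩
  · obtain ⟨i, b, h, rfl⟩ := mem_graph.1 hz
    exact ZFSet.pair_mem_prod.2 ⟨(hp i).2 ⟨b, h⟩, mem_two.2 ⟨b, rfl⟩⟩
  · obtain ⟨i, rfl⟩ := mem_omega.1 (hD z hz)
    obtain ⟨b, hb⟩ := (hp i).1 hz
    refine ⟨bit b, pair_mem_graph.2 hb, fun w hw => ?_⟩
    obtain ⟨j, c, h, e⟩ := mem_graph.1 hw
    obtain ⟨h1, rfl⟩ := ZFSet.pair_injective e
    rw [← num_injective h1, hb, Option.some_inj] at h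
    rw [h]

open scoped Classical in
theorem eq_graph_of_isFunc {D f : ZFSet.{u}} (hD : ∀ z ∈ D, z ∈ ZFSet.omega)
    (hf : ZFSet.IsFunc D two f) : f = graph fun i => if num i ∈ D then
      some (decide (ZFSet.pair (num i) (num 1) ∈ f)) else none := by
  have key : ∀ i b, num i ∈ D → (ZFSet.pair (num i) (bit b) ∈ f ↔
      decide (ZFSet.pair (num i) (num 1) ∈ f) = b) := by
    intro i b hi
    obtain ⟨w, hw, hu⟩ := hf.2 _ hi
    obtain ⟨c, rfl⟩ : ∃ c, w = bit c := mem_two.1 (ZFSet.pair_mem_prod.1 (hf.1 hw)).2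
    have hc : ∀ b, ZFSet.pair (num i) (bit b) ∈ f ↔ b = c :=
      fun b => ⟨fun h => bit_injective (hu _ h), fun h => h ▸ hw⟩
    have h1 := hc true
    change ZFSet.pair (num i) (num 1) ∈ f ↔ _ at h1
    rw [hc, h1]
    cases b <;> cases c <;> simp
  ext z
  rw [mem_graph]
  constructor
  · intro hz
    obtain ⟨a, ha, b, hb, rfl⟩ := ZFSet.mem_prod.1 (hf.1 hz)
    obtain ⟨i, rfl⟩ := mem_omega.1 (hD a ha)
    obtain ⟨c, rfl⟩ := mem_two.1 hb
    exact ⟨i, c, by rw [if_pos ha, (key i c ha).1 hz], rfl⟩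
  · rintro ⟨i, b, h, rfl⟩
    split_ifs at h with hi
    exact (key i b hi).2 (Option.some_inj.1 h)

/-- The set of natural numbers of which the real `x` is the characteristic function. -/
def toSet (x : ZFSet.{u}) : Set ℕ := {n | ZFSet.pair (num n) (num 1) ∈ x}

/-- The characteristic function of `A`. -/
noncomputable def realOf (A : Set ℕ) : ZFSet.{u} :=
  open scoped Classical in graph fun i => some (decide (i ∈ A))

/-- The finite sequence `l` as an element of `2^{<ω}`. -/
noncomputable def nodeOf (l : List Bool) : ZFSet.{u} := graph fun i => l[i]?

theorem isReal_realOf (A : Set ℕ) : IsReal (realOf.{u} A) :=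
  isFunc_graph (fun _ h => h) fun i => by simp [num_mem_omega]

theorem toSet_realOf (A : Set ℕ) : toSet (realOf.{u} A) = A := by
  ext n
  change ZFSet.pair (num n) (bit true) ∈ realOf A ↔ _
  rw [realOf, pair_mem_graph]
  simp

theorem IsReal.eq_realOf {x : ZFSet.{u}} (hx : IsReal x) : x = realOf (toSet x) := by
  refine (eq_graph_of_isFunc (fun _ h => h) hx).trans ?_
  simp only [num_mem_omega, if_true]
  rfl

theorem isNode_iff {s : ZFSet.{u}} : IsNode s ↔ ∃ l, s = nodeOf l := by
  constructor
  · rintro ⟨n, hn, hs⟩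
    obtain ⟨n, rfl⟩ := mem_omega.1 hn
    refine ⟨seg (toSet s) n, (eq_graph_of_isFunc (fun z hz => ?_) hs).trans ?_⟩
    · obtain ⟨m, -, rfl⟩ := mem_num.1 hz
      exact num_mem_omega m
    · refine congrArg graph (funext fun i => ?_)
      rw [num_mem_num]
      split_ifs with h
      · rw [seg, List.getElem?_map, List.getElem?_range h]
        rfl
      · rw [List.getElem?_eq_none (by rw [length_seg]; omega)]
  · rintro ⟨l, rfl⟩
    refine ⟨num l.length, num_mem_omega _, isFunc_graph (fun z hz => ?_) fun i => ?_⟩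
    · obtain ⟨m, -, rfl⟩ := mem_num.1 hz
      exact num_mem_omega m
    · rw [num_mem_num]
      exact ⟨fun h => ⟨_, List.getElem?_eq_getElem h⟩,
        fun ⟨b, hb⟩ => (List.getElem?_eq_some_iff.1 hb).1⟩

theorem nodeOf_subset {l l' : List Bool} : nodeOf.{u} l ⊆ nodeOf l' ↔ l <+: l' := by
  rw [nodeOf, nodeOf, graph_subset, List.prefix_iff_getElem?]
  constructor
  · exact fun h i hi => h i _ (List.getElem?_eq_getElem hi)
  · intro h i b hb
    obtain ⟨hi, rfl⟩ := List.getElem?_eq_some_iff.1 hb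
    exact h i hi

theorem nodeOf_injective : Function.Injective nodeOf.{u} := by
  intro l l' h
  exact List.ext_getElem? fun i => congrFun (graph_injective h) i

theorem nodeOf_subset_realOf {l : List Bool} {A : Set ℕ} :
    nodeOf.{u} l ⊆ realOf A ↔ Init l A := by
  rw [nodeOf, realOf, graph_subset]
  refine forall₃_congr fun i b _ => ?_
  rw [Option.some_inj]
  cases b <;> simp

/-- The finite sequences that belong to the tree `T`. -/
def treeOf (T : ZFSet.{u}) : Set (List Bool) := {l | nodeOf l ∈ T}

theorem IsPerfectTree.isPTree {T : ZFSet.{u}} (hT : IsPerfectTree T) : IsPTree (treeOf T) := by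
  obtain ⟨⟨hn, hd⟩, ⟨s, hs⟩, hsp⟩ := hT
  refine ⟨fun s hs t hts => ?_, ?_, fun s hs => ?_⟩
  · exact hd _ hs _ (isNode_iff.2 ⟨t, rfl⟩) (nodeOf_subset.2 hts)
  · obtain ⟨l, rfl⟩ := isNode_iff.1 (hn s hs)
    exact hd _ hs _ (isNode_iff.2 ⟨[], rfl⟩) (nodeOf_subset.2 List.nil_prefix)
  · obtain ⟨t, ht, t', ht', h⟩ := hsp (nodeOf s) hs
    obtain ⟨l, rfl⟩ := isNode_iff.1 (hn t ht)
    obtain ⟨l', rfl⟩ := isNode_iff.1 (hn t' ht')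
    simp only [nodeOf_subset] at h
    exact ⟨l, ht, l', ht', h.1, h.2.1, h.2.2⟩

theorem IsBranch.branch {T x : ZFSet.{u}} (h : IsBranch T x) : Branch (treeOf T) (toSet x) := by
  intro s hs
  refine h.2 _ (isNode_iff.2 ⟨s, rfl⟩) ?_
  rw [h.1.eq_realOf]
  exact nodeOf_subset_realOf.2 hs

theorem isPerfectTree_of_isPTree {T : ZFSet.{u}} {S : Set (List Bool)} (hS : IsPTree S)
    (hT : ∀ s, s ∈ T ↔ ∃ l ∈ S, s = nodeOf l) : IsPerfectTree T := by
  refine ⟨⟨fun s hs => ?_, fun s hs t ht hts => ?_⟩, ⟨_, (hT _).2 ⟨[], hS.nil_mem, rfl⟩⟩,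
    fun s hs => ?_⟩
  · obtain ⟨l, -, rfl⟩ := (hT s).1 hs
    exact isNode_iff.2 ⟨l, rfl⟩
  · obtain ⟨l, hl, rfl⟩ := (hT s).1 hs
    obtain ⟨l', rfl⟩ := isNode_iff.1 ht
    exact (hT _).2 ⟨l', hS.down l hl l' (nodeOf_subset.1 hts), rfl⟩
  · obtain ⟨l, hl, rfl⟩ := (hT s).1 hs
    obtain ⟨t, ht, t', ht', h1, h2, h3, h4⟩ := hS.split l hl
    refine ⟨nodeOf t, (hT _).2 ⟨t, ht, rfl⟩, nodeOf t', (hT _).2 ⟨t', ht', rfl⟩, ?_⟩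
    simp only [nodeOf_subset]
    exact ⟨h1, h2, h3, h4⟩

end Graphs

/-! ### Reals and trees of a transitive model -/

section Coded

variable {M : Set ZFSet.{u}}

/-- The set `A` of natural numbers belongs to `M`. -/
def Coded (h : IsTransitiveZF M) (A : Set ℕ) : Prop :=
  Ar (definableFamilies h) (fun _ n => n ∈ A)

/-- The real is variable 0 of the assignment rather than a parameter; this allows definable families
of reals, such as `K` in `exists_bound_or_enumeration`. -/
theorem ar_toSet (h : IsTransitiveZF M) :
    Ar (definableFamilies h) (fun v n => n ∈ toSet (v 0).1) := by
  rw [ar_nat]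
  exact ⟨fun a v => ZFSet.pair a.1 (h.numM 1).1 ∈ (v 0).1, Def.auto, fun v n => Iff.rfl⟩

theorem coded_toSet (h : IsTransitiveZF M) {x : ZFSet.{u}} (hx : x ∈ M) : Coded h (toSet x) := by
  let x' : M := ⟨x, hx⟩
  rw [Coded, ar_nat]
  exact ⟨fun a _ => ZFSet.pair a.1 (h.numM 1).1 ∈ x'.1, Def.auto, fun v n => Iff.rfl⟩

/-- A definable family of sets gives, at a fixed assignment, a definable set. -/
theorem Coded.exists_def (h : IsTransitiveZF M) {α : Type*} [Primcodable α] {A : Set α}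
    (hA : Ar (definableFamilies h) (fun _ a => a ∈ A)) :
    ∃ Q : M → Prop, Def (fun v => Q (v 0)) ∧
      ∀ n, Q (h.numM n) ↔ ∃ a, Encodable.decode n = some a ∧ a ∈ A := by
  obtain ⟨Q, dQ, hQ⟩ := hA
  refine ⟨fun x => Q x fun _ => h.numM 0, ?_, fun n => hQ _ n⟩
  exact dQ.subst (fun i => match i with
    | 0 => fun v => v 0
    | _ + 1 => fun _ => h.numM 0) fun i => by cases i; exacts [Tm.var _, Tm.const _]

/-- Replacement over ω, sending n to the pair of n and its bit. Together with `coded_toSet` this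
identifies the coded sets of numbers with the reals of M. -/
theorem realOf_mem (h : IsTransitiveZF M) {A : Set ℕ} (hA : Coded h A) : realOf A ∈ M := by
  classical
  obtain ⟨Q, dQ, hQ⟩ := Coded.exists_def h hA
  have hbit : ∀ b, bit b ∈ M := fun b => h.num_mem _
  have dP : Def (fun v : ℕ → M => (Q (v 0) ∧ (v 1).1 = ZFSet.pair (v 0).1 (h.numM 1).1) ∨
    (¬ Q (v 0) ∧ (v 1).1 = ZFSet.pair (v 0).1 (h.numM 0).1)) := Def.auto
  have hP : ∀ (n : ℕ) (y : M), ((Q (h.numM n) ∧ y.1 = ZFSet.pair (h.numM n).1 (h.numM 1).1) ∨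
      (¬ Q (h.numM n) ∧ y.1 = ZFSet.pair (h.numM n).1 (h.numM 0).1)) ↔
      y.1 = ZFSet.pair (num n) (bit (decide (n ∈ A))) := by
    intro n y
    have : Q (h.numM n) ↔ n ∈ A := by rw [hQ]; simp
    have e : ∀ k, (h.numM k).1 = num k := fun _ => rfl
    by_cases hn : n ∈ A <;> simp [this, hn, bit, e]
  obtain ⟨b, hb⟩ := h.zf.repl (P := fun x y : M => (Q x ∧ y.1 = ZFSet.pair x.1 (h.numM 1).1) ∨
    (¬ Q x ∧ y.1 = ZFSet.pair x.1 (h.numM 0).1)) dP h.omegaM (by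
      rintro ⟨x, hx⟩ hxo
      obtain ⟨n, rfl⟩ := mem_omega.1 hxo
      refine ⟨⟨_, h.pair_mem (h.num_mem n) (hbit (decide (n ∈ A)))⟩, (hP n _).2 rfl,
        fun y hy => Subtype.ext ((hP n y).1 hy)⟩)
  simp only [h.exists_omega, hP] at hb
  have : (b : ZFSet.{u}) = realOf A := by
    refine h.eq_of_mem_iff b.2 (fun z hz => ?_) fun z hz => (hb ⟨z, hz⟩).trans ?_
    · obtain ⟨i, b, -, rfl⟩ := mem_graph.1 hz
      exact h.pair_mem (h.num_mem _) (hbit _)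
    · rw [realOf, mem_graph]
      simp
  exact this ▸ b.2

theorem exists_nodeCode (h : IsTransitiveZF M) : ∃ Q : M → M → Prop,
    Def (fun v => Q (v 0) (v 1)) ∧ ∀ (l : List Bool) (n : ℕ) (s : M),
      Encodable.decode n = some l → (Q (h.numM n) s ↔ s.1 = nodeOf l) := by
  have hg : Primrec (fun k : ℕ => Encodable.encode
      ((Encodable.decode (α := List Bool) k.unpair.1).bind fun l => l[k.unpair.2]?)) := by
    refine Primrec.encode.comp (Primrec.option_bind (Primrec.decode.comp
      (Primrec.fst.comp Primrec.unpair)) ?_)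
    exact (Primrec.list_getElem?.comp Primrec.snd
      (Primrec.snd.comp (Primrec.unpair.comp Primrec.fst))).to₂
  obtain ⟨Qg, dg, hQg⟩ := Graph₁.of_primrec h (Primrec.nat_iff.1 hg)
  obtain ⟨Qp, dp, hQp⟩ := Graph₂.pair h
  let o := h.omegaM
  let z₀ := h.numM 0
  let z₁ := h.numM 1
  let z₂ := h.numM 2
  -- The i-th entry is an optional bit with code 0 past the end, 1 for `false` and 2 for `true`.
  -- Hence code 1 goes with the value 0, and code 2 with the value 1.
  refine ⟨fun n s => ∀ z : M, z.1 ∈ s.1 ↔ ∃ i : M, i.1 ∈ o.1 ∧ ∃ k : M, k.1 ∈ o.1 ∧ (Qp n i k ∧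
    ((Qg k z₁ ∧ z.1 = ZFSet.pair i.1 z₀.1) ∨ (Qg k z₂ ∧ z.1 = ZFSet.pair i.1 z₁.1))),
    Def.auto, fun l n s hl => ?_⟩
  simp only [o, z₀, z₁, z₂, h.exists_omega, hQg, hQp]
  have key : ∀ z, (∃ i k : ℕ, Nat.pair n i = k ∧
      ((Encodable.encode ((Encodable.decode (α := List Bool) k.unpair.1).bind
        fun l => l[k.unpair.2]?) = 1 ∧ z = ZFSet.pair (h.numM i).1 (h.numM 0).1) ∨
      (Encodable.encode ((Encodable.decode (α := List Bool) k.unpair.1).bind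
        fun l => l[k.unpair.2]?) = 2 ∧ z = ZFSet.pair (h.numM i).1 (h.numM 1).1))) ↔
      z ∈ nodeOf l := by
    intro z
    rw [nodeOf, mem_graph]
    refine exists_congr fun i => ?_
    simp only [exists_eq_left', Nat.unpair_pair, hl, Option.bind_some, Bool.exists_bool]
    refine or_congr (and_congr ?_ Iff.rfl) (and_congr ?_ Iff.rfl) <;>
    · rcases l[i]? with _ | _ | _ <;> simp
  simp only [key]
  constructor
  · intro H
    refine h.eq_of_mem_iff s.2 (fun z hz => ?_) fun z hz => H ⟨z, hz⟩
    obtain ⟨i, b, -, rfl⟩ := mem_graph.1 hz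
    exact h.pair_mem (h.num_mem _) (h.num_mem _)
  · exact fun H z => by rw [H]

theorem ar_treeOf (h : IsTransitiveZF M) {T : ZFSet.{u}} (hT : T ∈ M) :
    Ar (definableFamilies h) (fun _ s => s ∈ treeOf T) := by
  obtain ⟨Q, dQ, hQ⟩ := exists_nodeCode h
  let T' : M := ⟨T, hT⟩
  have h1 : (fun (_ : ℕ → M) (n : ℕ) => ∃ s : M, Q (h.numM n) s ∧ s.1 ∈ T'.1) ∈
      definableFamilies h := ⟨fun x _ => ∃ s : M, Q x s ∧ s.1 ∈ T'.1, Def.auto, fun _ _ => Iff.rfl⟩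
  have h2 : Ar (definableFamilies h) (fun _ (_ : List Bool) => True) :=
    Ar.of_primrec h.arithClosed ⟨fun _ => isTrue trivial, Primrec.const true⟩
  have := h.arithClosed.and h1 h2
  unfold Ar
  convert this using 3 with _ n
  constructor
  · rintro ⟨l, hl, hlT⟩
    exact ⟨⟨⟨_, h.transitive _ hT _ hlT⟩, (hQ l n _ hl).2 rfl, hlT⟩, l, hl, trivial⟩
  · rintro ⟨⟨s, hs, hsT⟩, l, hl, -⟩
    rw [hQ l n s hl] at hs
    exact ⟨l, hl, show nodeOf l ∈ T from hs ▸ hsT⟩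

/-- All nodes of S already lie in T, so separation from T suffices. -/
theorem exists_tree (h : IsTransitiveZF M) {T : ZFSet.{u}} (hT : T ∈ M) {S : Set (List Bool)}
    (hS : Ar (definableFamilies h) (fun _ s => s ∈ S)) (hST : S ⊆ treeOf T) :
    ∃ S' ∈ M, ∀ s, s ∈ S' ↔ ∃ l ∈ S, s = nodeOf l := by
  obtain ⟨Q, dQ, hQ⟩ := exists_nodeCode h
  obtain ⟨QS, dS, hQS⟩ := Coded.exists_def h hS
  let o := h.omegaM
  have dP : Def (fun v : ℕ → M => ∃ n : M, n.1 ∈ o.1 ∧ (QS n ∧ Q n (v 0))) := Def.auto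
  obtain ⟨b, hb⟩ := h.zf.sep (P := fun s => ∃ n : M, n.1 ∈ o.1 ∧ (QS n ∧ Q n s)) dP ⟨T, hT⟩
  simp only [o, h.exists_omega, hQS] at hb
  have key : ∀ s : M, (s.1 ∈ T ∧ ∃ n, (∃ l, Encodable.decode n = some l ∧ l ∈ S) ∧
      Q (h.numM n) s) ↔ ∃ l ∈ S, s.1 = nodeOf l := by
    intro s
    constructor
    · rintro ⟨-, n, ⟨l, hl, hlS⟩, hn⟩
      exact ⟨l, hlS, (hQ l n s hl).1 hn⟩
    · rintro ⟨l, hl, e⟩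
      refine ⟨e ▸ hST hl, Encodable.encode l, ⟨l, Encodable.encodek l, hl⟩, ?_⟩
      exact (hQ l _ s (Encodable.encodek l)).2 e
  refine ⟨b, b.2, fun s => ⟨fun hs => ?_, ?_⟩⟩
  · exact (key ⟨s, h.transitive _ b.2 _ hs⟩).1 ((hb _).1 hs)
  · rintro ⟨l, hl, rfl⟩
    have hM : nodeOf l ∈ M := h.transitive _ hT _ (hST hl)
    exact (hb ⟨_, hM⟩).2 ((key ⟨_, hM⟩).2 ⟨l, hl, rfl⟩)

end Coded

/-! ### Enumerations of the reals of an inner model -/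

theorem exists_mem_minimal {P : ZFSet.{u} → Prop} (h : ∃ x, P x) :
    ∃ x, P x ∧ ∀ y ∈ x, ¬ P y := by
  obtain ⟨x, hx, hmin⟩ := ZFSet.mem_wf.has_min {x | P x} h
  exact ⟨x, hx, fun y hy hP => hmin y hP hy⟩

section Enumeration

variable {V W : Set ZFSet.{u}} {κ R f : ZFSet.{u}}

/-- For every `α < κ`, the first `α + 1` reals of an enumeration in length `κ` are the rows of a
single real. -/
theorem exists_cover (hW : IsTransitiveZF W) (hf : f ∈ W) (hfb : IsBijection κ R f) {α : ZFSet.{u}}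
    (hα : α ∈ κ) (hαc : CountableIn W α) :
    ∃ r, Coded hW r ∧ ∀ β x, ZFSet.pair β x ∈ f → (β ∈ α ∨ β = α) → ∃ n, row r n = toSet x := by
  obtain ⟨e, heW, hef, hei⟩ := hαc
  obtain ⟨x₀, hx₀, hx₀u⟩ := hfb.1.1.2 α hα
  obtain ⟨Qp, dp, hQp⟩ := Graph₂.pair hW
  let f' : W := ⟨f, hf⟩
  let e' : W := ⟨e, heW⟩
  let x' : W := ⟨x₀, (hW.fst_snd_mem hf hx₀).2⟩
  let o := hW.omegaM
  let z₀ := hW.numM 0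
  let z₁ := hW.numM 1
  -- Row 0 is the real with index α. Row n + 1 is the real whose index e sends to n, and is empty if
  -- there is none.
  let r : Set ℕ := {k | (k.unpair.1 = 0 ∧ k.unpair.2 ∈ toSet x₀) ∨ ∃ n, k.unpair.1 = n + 1 ∧
    ∃ β x : W, ZFSet.pair β.1 (num n) ∈ e ∧ ZFSet.pair β.1 x.1 ∈ f ∧ k.unpair.2 ∈ toSet x.1}
  refine ⟨r, ?_, fun β x hβx hβ => ?_⟩
  · rw [Coded, ar_nat]
    refine ⟨fun k _ => ∃ i : W, i.1 ∈ o.1 ∧ ∃ j : W, j.1 ∈ o.1 ∧ (Qp i j k ∧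
      ((i = z₀ ∧ ZFSet.pair j.1 z₁.1 ∈ x'.1) ∨ ∃ n : W, n.1 ∈ o.1 ∧ (i.1 = insert n.1 n.1 ∧
        ∃ β : W, ∃ x : W, ZFSet.pair β.1 n.1 ∈ e'.1 ∧ ZFSet.pair β.1 x.1 ∈ f'.1 ∧
          ZFSet.pair j.1 z₁.1 ∈ x.1))), Def.auto, fun v k => ?_⟩
    simp only [o, hW.exists_omega, hQp]
    have h1 : ∀ i, hW.numM i = z₀ ↔ i = 0 := fun i => by
      rw [Subtype.ext_iff]; exact num_inj
    have h2 : ∀ i n, (hW.numM i).1 = insert (hW.numM n).1 (hW.numM n).1 ↔ i = n + 1 :=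
      fun i n => num_inj (m := i) (n := n + 1)
    simp only [h1, h2]
    constructor
    · rintro ⟨i, j, rfl, h⟩
      change _ ∨ _
      rw [Nat.unpair_pair]
      exact h
    · intro h
      exact ⟨k.unpair.1, k.unpair.2, Nat.pair_unpair k, h⟩
  · rcases hβ with hβ | rfl
    · obtain ⟨y, hy, -⟩ := hef.2 β hβ
      obtain ⟨n, rfl⟩ := mem_omega.1 (ZFSet.pair_mem_prod.1 (hef.1 hy)).2
      refine ⟨n + 1, ?_⟩
      ext m
      change (_ ∨ _) ↔ _
      simp only [Nat.unpair_pair, Nat.add_eq_zero_iff, one_ne_zero, and_false, false_and,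
        false_or, Nat.add_right_cancel_iff]
      constructor
      · rintro ⟨_, rfl, β', x', h1, h2, h3⟩
        have := hei _ _ _ h1 hy
        rw [this] at h2
        obtain ⟨w, -, hw⟩ := hfb.1.1.2 β (ZFSet.pair_mem_prod.1 (hfb.1.1.1 hβx)).1
        rwa [hw _ hβx, ← hw _ h2]
      · intro hm
        obtain ⟨h1, h2⟩ := hW.fst_snd_mem hf hβx
        exact ⟨n, rfl, ⟨β, h1⟩, ⟨x, h2⟩, hy, hβx, hm⟩
    · refine ⟨0, ?_⟩
      rw [hx₀u x hβx]
      ext m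
      change (_ ∨ _) ↔ _
      simp only [Nat.unpair_pair, true_and]
      refine or_iff_left ?_
      rintro ⟨n, hn, -⟩
      omega

theorem Coded.mono (hV : IsTransitiveZF V) (hW : IsTransitiveZF W) (hWV : W ⊆ V) {A : Set ℕ}
    (hA : Coded hW A) : Coded hV A := by
  rw [← toSet_realOf.{u} A]
  exact coded_toSet hV (hWV (realOf_mem hW hA))

/-- A sequence of sequences of reals, as a sequence indexed by pairs. -/
theorem ar_uncurry {ι : Type*} {𝒞 : Set (ι → ℕ → Prop)} (h : ArithClosed 𝒞) {Y : Set ℕ}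
    (hY : Ar 𝒞 (fun _ n => n ∈ Y)) :
    Ar 𝒞 (fun _ k => k ∈ {k : ℕ |
      Nat.pair k.unpair.1.unpair.1 (Nat.pair k.unpair.1.unpair.2 k.unpair.2) ∈ Y}) :=
  have h₁ : Primrec fun k : ℕ => k.unpair.1.unpair :=
    Primrec.unpair.comp (Primrec.fst.comp Primrec.unpair)
  Ar.mem h (X := fun _ => Y) hY (Primrec₂.natPair.comp (Primrec.fst.comp h₁)
    (Primrec₂.natPair.comp (Primrec.snd.comp h₁) (Primrec.snd.comp Primrec.unpair)))

set_option maxHeartbeats 1000000 in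
/-- Let `K s` be definable families of reals, indexed by the nodes of a tree, each of which contains
a real of `W`. Either these reals can be found below a common bound `α < κ`, or `V` contains an
enumeration of all reals of `W`. -/
theorem exists_bound_or_enumeration (hV : IsTransitiveZF V) (hW : IsTransitiveZF W) (hWV : W ⊆ V)
    (hf : f ∈ W) (hκ : κ.IsOrdinal) (hκc : ∀ α ∈ κ, CountableIn W α)
    (hR : ∀ x, x ∈ R ↔ x ∈ realsOf W) (hfb : IsBijection κ R f)
    {T : Set (List Bool)} {K : List Bool → Set ℕ → Prop}
    (hK : Ar (definableFamilies hV) (fun v s => s ∈ {s | K s (toSet (v 0).1)}))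
    (hTK : ∀ s ∈ T, ∃ β x, ZFSet.pair β x ∈ f ∧ K s (toSet x)) :
    (∃ α ∈ κ, ∀ s ∈ T, ∃ β x, (β ∈ α ∨ β = α) ∧ ZFSet.pair β x ∈ f ∧ K s (toSet x)) ∨
      ∃ Y, Coded hV Y ∧ ∀ x ∈ R, ∃ n, toSet x = row Y n := by
  by_contra hcon
  push Not at hcon
  obtain ⟨hnb, hne⟩ := hcon
  have hdom : ∀ {β x}, ZFSet.pair β x ∈ f → β ∈ κ ∧ x ∈ R := fun h =>
    ZFSet.pair_mem_prod.1 (hfb.1.1.1 h)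
  have hfun : ∀ {β x x'}, ZFSet.pair β x ∈ f → ZFSet.pair β x' ∈ f → x = x' := by
    intro β x x' h h'
    obtain ⟨w, -, hw⟩ := hfb.1.1.2 β (hdom h).1
    rw [hw _ h, hw _ h']
  have hfV : ∀ {β x}, ZFSet.pair β x ∈ f → β ∈ V ∧ x ∈ V := fun h =>
    hV.fst_snd_mem (hWV hf) h
  obtain ⟨QK, dK, hQK⟩ : ∃ Q : V → V → Prop, Def (fun v => Q (v 0) (v 1)) ∧
      ∀ (s : List Bool) (x : V), Q (hV.numM (Encodable.encode s)) x ↔ K s (toSet x.1) := by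
    obtain ⟨Q, dQ, hQ⟩ := hK
    refine ⟨fun n x => Q n fun _ => x, ?_, fun s x => ?_⟩
    · exact dQ.subst (fun i v => match i with
        | 0 => v 0
        | _ + 1 => v 1) fun i => by cases i <;> exact Tm.var _
    · exact (hQ (fun _ => x) _).trans (by simp)
  obtain ⟨Qp, dp, hQp⟩ := Graph₂.pair hV
  let f' : V := ⟨f, hWV hf⟩
  let o := hV.omegaM
  let z₁ := hV.numM 1
  -- For n the code of s, the rows of the real with index δ include every real whose index has no
  -- index before it satisfying `K s`, that is, every real up to the least index β_s. Taking the
  -- least such δ selects these reals definably for all s at once.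
  let E : V → V → Prop := fun n δ => ∃ d : V, ZFSet.pair δ.1 d.1 ∈ f'.1 ∧
    ∀ β : V, ∀ x : V, ZFSet.pair β.1 x.1 ∈ f'.1 →
      (∀ β' : V, ∀ x' : V, β'.1 ∈ β.1 → ZFSet.pair β'.1 x'.1 ∈ f'.1 → ¬ QK n x') →
      ∃ i : V, i.1 ∈ o.1 ∧ ¬ ∃ j : V, j.1 ∈ o.1 ∧ ∃ k : V, k.1 ∈ o.1 ∧
        (Qp i j k ∧ ¬ (ZFSet.pair k.1 z₁.1 ∈ d.1 ↔ ZFSet.pair j.1 z₁.1 ∈ x.1))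
  have dE : Def (fun v : ℕ → V => E (v 0) (v 1)) := Def.auto
  let Em : V → V → Prop := fun n δ => E n δ ∧ ∀ δ' : V, δ'.1 ∈ δ.1 → ¬ E n δ'
  have dEm : Def (fun v : ℕ → V => Em (v 0) (v 1)) :=
    dE.and (Def.all ((Def.mem (Tm.var 0) (Tm.var 2)).imp
      (Def.not (dE.rel₂ (Tm.var 1) (Tm.var 0)))))
  have hE : ∀ (s : List Bool) (δ : V), E (hV.numM (Encodable.encode s)) δ →
      ∃ d, ZFSet.pair δ.1 d ∈ f ∧ ∀ β x, ZFSet.pair β x ∈ f →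
        (∀ β' x', β' ∈ β → ZFSet.pair β' x' ∈ f → ¬ K s (toSet x')) →
        ∃ i, row (toSet d) i = toSet x := by
    rintro s δ ⟨d, hd, hd'⟩
    refine ⟨d, hd, fun β x hβx hβ => ?_⟩
    obtain ⟨hβV, hxV⟩ := hfV hβx
    have := hd' ⟨β, hβV⟩ ⟨x, hxV⟩ hβx fun β' x' h1 h2 h3 => hβ β' x' h1 h2 ((hQK s x').1 h3)
    simp only [o, hV.exists_omega, hQp, exists_eq_left'] at this
    obtain ⟨i, hi⟩ := this
    push Not at hi
    exact ⟨i, Set.ext hi⟩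
  have hEex : ∀ s ∈ T, ∃ δ : V, E (hV.numM (Encodable.encode s)) δ := by
    intro s hs
    obtain ⟨β₀, ⟨x₀, hx₀, hK₀⟩, hmin⟩ := exists_mem_minimal (hTK s hs)
    -- The real that codes the enumeration up to β₀ belongs to W, so it has itself an index δ in the
    -- enumeration.
    obtain ⟨r, hr, hcov⟩ := exists_cover hW hf hfb (hdom hx₀).1 (hκc _ (hdom hx₀).1)
    have hrR : realOf r ∈ R := (hR _).2 ⟨realOf_mem hW hr, isReal_realOf r⟩
    obtain ⟨δ, hδ, hδr⟩ := hfb.2 _ hrR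
    refine ⟨⟨δ, (hfV hδr).1⟩, ⟨_, (hfV hδr).2⟩, hδr, fun β x hβx hβ => ?_⟩
    have h1 : β.1 ∈ β₀ ∨ β.1 = β₀ := by
      rcases (hκ.mem (hdom hβx).1).mem_trichotomous (hκ.mem (hdom hx₀).1) with h | h | h
      · exact Or.inl h
      · exact Or.inr h
      · exact absurd ((hQK s ⟨x₀, (hfV hx₀).2⟩).2 hK₀) (hβ ⟨β₀, (hfV hx₀).1⟩ _ h hx₀)
    obtain ⟨i, hi⟩ := hcov _ _ hβx h1
    simp only [o, hV.exists_omega, hQp, exists_eq_left']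
    refine ⟨i, ?_⟩
    rintro ⟨j, hj⟩
    refine hj ?_
    have h2 : Nat.pair i j ∈ toSet (realOf r) ↔ j ∈ toSet x.1 := by
      rw [toSet_realOf, ← hi]
      rfl
    exact h2
  have hEm : ∀ s ∈ T, ∃ δ : V, Em (hV.numM (Encodable.encode s)) δ := by
    intro s hs
    obtain ⟨δ, hδ⟩ := hEex s hs
    obtain ⟨δ', ⟨hV', hδ'⟩, hmin⟩ := exists_mem_minimal
      (P := fun δ => ∃ h : δ ∈ V, E (hV.numM (Encodable.encode s)) ⟨δ, h⟩) ⟨δ.1, δ.2, hδ⟩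
    exact ⟨⟨δ', hV'⟩, hδ', fun δ'' h h' => hmin δ''.1 h ⟨δ''.2, h'⟩⟩
  have hEmu : ∀ (s : List Bool) (δ δ' : V), Em (hV.numM (Encodable.encode s)) δ →
      Em (hV.numM (Encodable.encode s)) δ' → δ = δ' := by
    intro s δ δ' h h'
    obtain ⟨d, hd, -⟩ := hE s δ h.1
    obtain ⟨d', hd', -⟩ := hE s δ' h'.1
    rcases (hκ.mem (hdom hd).1).mem_trichotomous (hκ.mem (hdom hd').1) with hl | he | hl
    · exact absurd h.1 (h'.2 δ hl)
    · exact Subtype.ext he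
    · exact absurd h'.1 (h.2 δ' hl)
  let Y : Set ℕ := {k | ∃ δ d : V, Em (hV.numM k.unpair.1) δ ∧ ZFSet.pair δ.1 d.1 ∈ f ∧
    k.unpair.2 ∈ toSet d.1}
  have hY : Ar (definableFamilies hV) (fun _ n => n ∈ Y) := by
    rw [ar_nat]
    refine ⟨fun k _ => ∃ i : V, i.1 ∈ o.1 ∧ ∃ j : V, j.1 ∈ o.1 ∧ (Qp i j k ∧
      ∃ δ : V, ∃ d : V, Em i δ ∧ ZFSet.pair δ.1 d.1 ∈ f'.1 ∧ ZFSet.pair j.1 z₁.1 ∈ d.1),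
      Def.auto, fun v k => ?_⟩
    simp only [o, hV.exists_omega, hQp]
    constructor
    · rintro ⟨i, j, rfl, h⟩
      change ∃ δ d : V, _
      rw [Nat.unpair_pair]
      exact h
    · intro h
      exact ⟨k.unpair.1, k.unpair.2, Nat.pair_unpair k, h⟩
  let Y' : Set ℕ := {k | Nat.pair k.unpair.1.unpair.1 (Nat.pair k.unpair.1.unpair.2 k.unpair.2) ∈ Y}
  have hYc : Coded hV Y' := ar_uncurry hV.arithClosed hY
  obtain ⟨x, hx, hYx⟩ := hne Y' hYc
  obtain ⟨β, hβκ, hβx⟩ := hfb.2 x hx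
  -- Unboundedness: no index up to β satisfies `K s`, so x comes before the least index for s and is
  -- a row of the real selected for s.
  obtain ⟨s, hs, hsβ⟩ := hnb β hβκ
  obtain ⟨δ, hδ⟩ := hEm s hs
  obtain ⟨d, hd, hcov⟩ := hE s δ hδ.1
  obtain ⟨i, hi⟩ := hcov β x hβx fun β' x' h1 h2 => hsβ β' x' (Or.inl h1) h2
  refine hYx (Nat.pair (Encodable.encode s) i) ?_
  rw [← hi]
  ext m
  change _ ↔ Nat.pair _ _ ∈ Y
  simp only [Nat.unpair_pair]
  change _ ↔ ∃ δ d : V, _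
  simp only [Nat.unpair_pair]
  constructor
  · exact fun hm => ⟨δ, ⟨d, (hfV hd).2⟩, hδ, hd, hm⟩
  · rintro ⟨δ', d', hδ', hd', hm⟩
    rw [hEmu s δ' δ hδ' hδ] at hd'
    rw [hfun hd hd']
    exact hm

/-- Either `V` enumerates the reals of `W` on some cone of `T`, or some real of `W` enumerates
branches of `T`, not among the rows of `r₀`, that are dense in `T`. -/
theorem exists_enumeration_or_dense (hV : IsTransitiveZF V) (hW : IsTransitiveZF W) (hWV : W ⊆ V)
    (hf : f ∈ W) (hκ : κ.IsOrdinal) (hκc : ∀ α ∈ κ, CountableIn W α)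
    (hR : ∀ x, x ∈ R ↔ x ∈ realsOf W) (hfb : IsBijection κ R f)
    {T : Set (List Bool)} (hT : IsPTree T) (hTA : Ar (definableFamilies hV) (fun _ s => s ∈ T))
    {r₀ : Set ℕ} (hr₀ : Coded hV r₀) :
    (∃ s ∈ T, ∃ Y, Coded hV Y ∧ ∀ x ∈ realsOf W, Init s (toSet x) → Branch T (toSet x) →
      ∃ n, toSet x = row Y n) ∨
    ∃ r, Coded hW r ∧ ∀ s ∈ T, ∃ n, Init s (row r n) ∧ Branch T (row r n) ∧
      ∀ i, row r₀ i ≠ row r n := by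
  have hC := hV.arithClosed
  -- Being different from a row is written with number quantifiers, which makes K visibly
  -- arithmetical.
  let K : List Bool → Set ℕ → Prop := fun s A =>
    Init s A ∧ (∀ t, Init t A → t ∈ T) ∧ ∀ i, ∃ m, ¬ (m ∈ row r₀ i ↔ m ∈ A)
  have hKi : ∀ s A, K s A ↔ Init s A ∧ Branch T A ∧ ∀ i, row r₀ i ≠ A := by
    intro s A
    refine and_congr Iff.rfl (and_congr Iff.rfl (forall_congr' fun i => ?_))
    rw [ne_eq, Set.ext_iff, not_forall]
  have hK : Ar (definableFamilies hV) (fun v s => s ∈ {s | K s (toSet (v 0).1)}) := by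
    have hX := ar_toSet hV
    have h1 : Ar (definableFamilies hV) (fun v (s : List Bool) => Init s (toSet (v 0).1)) :=
      Ar.init_const hC hX Primrec.id
    have h2 : Ar (definableFamilies hV) (fun v (p : List Bool × List Bool) =>
        Init p.2 (toSet (v 0).1)) := Ar.init_const hC hX primrec_auto
    have h3 : Ar (definableFamilies hV) (fun _ (p : (List Bool × ℕ) × ℕ) => p.2 ∈ row r₀ p.1.2) :=
      Ar.mem_row hC hr₀ primrec_auto primrec_auto
    have h4 : Ar (definableFamilies hV) (fun v (p : (List Bool × ℕ) × ℕ) =>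
        p.2 ∈ toSet (v 0).1) := Ar.mem hC hX primrec_auto
    have : Ar (definableFamilies hV) (fun v (s : List Bool) => Init s (toSet (v 0).1) ∧
        (∀ t, Init t (toSet (v 0).1) → t ∈ T) ∧
        ∀ i, ∃ m, ¬ (m ∈ row r₀ i ↔ m ∈ toSet (v 0).1)) := ar_auto hC
    exact this
  by_cases hTK : ∀ s ∈ T, ∃ β x, ZFSet.pair β x ∈ f ∧ K s (toSet x)
  · rcases exists_bound_or_enumeration hV hW hWV hf hκ hκc hR hfb hK hTK with
      ⟨α, hα, hb⟩ | ⟨Y, hY, hYR⟩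
    · obtain ⟨r, hr, hcov⟩ := exists_cover hW hf hfb hα (hκc α hα)
      refine Or.inr ⟨r, hr, fun s hs => ?_⟩
      obtain ⟨β, x, hβ, hβx, hx⟩ := hb s hs
      obtain ⟨n, hn⟩ := hcov β x hβx hβ
      exact ⟨n, hn ▸ (hKi s _).1 hx⟩
    · exact Or.inl ⟨[], hT.nil_mem, Y, hY, fun x hx _ _ => hYR x ((hR x).2 hx)⟩
  -- Some node s has no suitable real in W: every branch of T in W through s is a row of r₀, so r₀
  -- is the enumeration.
  · push Not at hTK
    obtain ⟨s, hs, hsK⟩ := hTK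
    refine Or.inl ⟨s, hs, r₀, hr₀, fun x hx hsx hTx => ?_⟩
    obtain ⟨β, -, hβx⟩ := hfb.2 x ((hR x).2 hx)
    by_contra hc
    push Not at hc
    exact hsK β x hβx ((hKi _ _).2 ⟨hsx, hTx, fun i => (hc i).symm⟩)

end Enumeration

/-! ### Conclusion: the two-coloured sequence of branches and the proof of the theorem -/

/-- Two sequences of reals, merged into one. -/
def merge (r₁ r₂ : Set ℕ) : Set ℕ := {k |
  (k.unpair.1.bodd = false ∧ Nat.pair k.unpair.1.div2 k.unpair.2 ∈ r₁) ∨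
  (k.unpair.1.bodd = true ∧ Nat.pair k.unpair.1.div2 k.unpair.2 ∈ r₂)}

theorem row_merge_even (r₁ r₂ : Set ℕ) (n : ℕ) : row (merge r₁ r₂) (2 * n) = row r₁ n := by
  ext m
  change (_ ∨ _) ↔ _
  simp [Nat.div2_val, row]

theorem row_merge_odd (r₁ r₂ : Set ℕ) (n : ℕ) : row (merge r₁ r₂) (2 * n + 1) = row r₂ n := by
  ext m
  change (_ ∨ _) ↔ _
  simp [Nat.div2_val, row]

theorem ar_merge {ι : Type*} {𝒞 : Set (ι → ℕ → Prop)} (h : ArithClosed 𝒞) {r₁ r₂ : Set ℕ}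
    (h₁ : Ar 𝒞 (fun _ n => n ∈ r₁)) (h₂ : Ar 𝒞 (fun _ n => n ∈ r₂)) :
    Ar 𝒞 (fun _ n => n ∈ merge r₁ r₂) := by
  have hp : Primrec (fun k : ℕ => Nat.pair k.unpair.1.div2 k.unpair.2) :=
    Primrec₂.natPair.comp (Primrec.nat_div2.comp (Primrec.fst.comp Primrec.unpair))
      (Primrec.snd.comp Primrec.unpair)
  have hb : Primrec (fun k : ℕ => k.unpair.1.bodd) :=
    Primrec.nat_bodd.comp (Primrec.fst.comp Primrec.unpair)
  exact ((Ar.eq h hb (Primrec.const false)).and h (Ar.mem h h₁ hp)).or h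
    ((Ar.eq h hb (Primrec.const true)).and h (Ar.mem h h₂ hp))

theorem inMarczewskiIdeal_of_isInnerModel {V W : Set ZFSet.{u}} (hV : IsTransitiveZFCModel V)
    (hW : IsInnerModel W V) (hCH : SatisfiesCH W)
    (hr : (realsOf V \ realsOf W).Nonempty) : InMarczewskiIdeal V (realsOf W) := by
  intro T hTV hT
  have hV' : IsTransitiveZF V := ⟨hV.transitive, hV.zfc.toIsZFModel⟩
  have hW' : IsTransitiveZF W := ⟨hW.transitive, hW.zf⟩
  obtain ⟨κ, ⟨-, hκ, -, hκc⟩, R, -, hR, f, hf, hfb⟩ := hCH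
  have hP := hT.isPTree
  have hPA := ar_treeOf hV' hTV
  have hCV := hV'.arithClosed
  have hCW := hW'.arithClosed
  have mono : ∀ {A}, Coded hW' A → Coded hV' A := fun h => h.mono hV' hW' hW.subset
  have key : ∃ S, IsPTree S ∧ S ⊆ treeOf T ∧ Ar (definableFamilies hV') (fun _ s => s ∈ S) ∧
      ∀ x ∈ realsOf W, ¬ Branch S (toSet x) := by
    have case_enum : (∃ s ∈ treeOf T, ∃ Y, Coded hV' Y ∧ ∀ x ∈ realsOf W, Init s (toSet x) →
        Branch (treeOf T) (toSet x) → ∃ n, toSet x = row Y n) →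
        ∃ S, IsPTree S ∧ S ⊆ treeOf T ∧ Ar (definableFamilies hV') (fun _ s => s ∈ S) ∧
          ∀ x ∈ realsOf W, ¬ Branch S (toSet x) := by
      rintro ⟨s, hs, Y, hY, hYx⟩
      obtain ⟨S, h1, h2, h3, h4⟩ := exists_ptree_avoiding_rows hCV hP hPA hY hs
      refine ⟨S, h1, h2, h3, fun x hx hb => ?_⟩
      obtain ⟨hi, hn⟩ := h4 _ hb
      obtain ⟨n, hn'⟩ := hYx x hx hi fun t ht => h2 (hb t ht)
      exact hn n hn'
    -- Every row of ∅ is the empty set, so the first application excludes just that one real, which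
    -- does no harm.
    have h0 : Coded hV' ∅ := Ar.of_primrec hCV ⟨fun _ => isFalse id, Primrec.const false⟩
    rcases exists_enumeration_or_dense hV' hW' hW.subset hf hκ hκc hR hfb hP hPA h0 with
      h | ⟨r₁, hr₁, hd₁⟩
    · exact case_enum h
    rcases exists_enumeration_or_dense hV' hW' hW.subset hf hκ hκc hR hfb hP hPA (mono hr₁) with
      h | ⟨r₂, hr₂, hd₂⟩
    · exact case_enum h
    obtain ⟨c, ⟨hcV, hcr⟩, hcW⟩ := hr
    let X := merge r₁ r₂
    -- The colour is defined from the row as a set, not from the parity of m, so equal rows have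
    -- equal colours. Rows of r₁ get one colour, and the dense branches taken from r₂, not being
    -- rows of r₁, get the other.
    let Par : Set ℕ := {m | ∃ i, ∀ k, k ∈ row r₁ i ↔ k ∈ row X m}
    have hParI : ∀ m, m ∈ Par ↔ ∃ i, row r₁ i = row X m := fun m =>
      exists_congr fun i => Set.ext_iff.symm
    have hX : Coded hW' X := ar_merge hCW hr₁ hr₂
    have hPar : Coded hW' Par := by
      have h1 : Ar (definableFamilies hW') (fun _ (p : (ℕ × ℕ) × ℕ) => p.2 ∈ row r₁ p.1.2) :=
        Ar.mem_row hCW hr₁ primrec_auto primrec_auto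
      have h2 : Ar (definableFamilies hW') (fun _ (p : (ℕ × ℕ) × ℕ) => p.2 ∈ row X p.1.1) :=
        Ar.mem_row hCW hX primrec_auto primrec_auto
      have : Ar (definableFamilies hW') (fun _ (m : ℕ) => ∃ i, ∀ k, k ∈ row r₁ i ↔ k ∈ row X m) :=
        ar_auto hCW
      exact this
    obtain ⟨S, h1, h2, h3, h4⟩ := exists_ptree_avoiding (c := toSet c) hCV hCW hP hPA (mono hX)
      (mono hPar) hX hPar (by
        intro s hs b
        by_cases hb : b
        · obtain ⟨n, hi, hB, -⟩ := hd₁ s hs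
          refine ⟨2 * n, ?_⟩
          rw [hParI, row_merge_even]
          exact ⟨hi, hB, iff_of_true ⟨n, rfl⟩ hb⟩
        · obtain ⟨n, hi, hB, hne⟩ := hd₂ s hs
          refine ⟨2 * n + 1, ?_⟩
          rw [hParI, row_merge_odd]
          exact ⟨hi, hB, iff_of_false (fun ⟨i, e⟩ => hne i e) hb⟩)
      (fun m m' e => by rw [hParI, hParI, e]) (coded_toSet hV' hcV) (fun hc => by
        refine hcW ⟨?_, hcr⟩
        rw [hcr.eq_realOf]
        exact realOf_mem hW' hc)
    exact ⟨S, h1, h2, h3, fun x hx hb => h4 _ hb (coded_toSet hW' hx.1)⟩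
  obtain ⟨S, h1, h2, h3, h4⟩ := key
  obtain ⟨S', hS'V, hS'⟩ := exists_tree hV' hTV h3 h2
  have hS'S : treeOf S' = S := by
    ext l
    change nodeOf l ∈ S' ↔ _
    rw [hS']
    exact ⟨fun ⟨l', hl', e⟩ => nodeOf_injective e ▸ hl', fun h => ⟨l, h, rfl⟩⟩
  refine ⟨S', hS'V, isPerfectTree_of_isPTree h1 hS', fun s hs => ?_, fun x _ hx hxW => ?_⟩
  · obtain ⟨l, hl, rfl⟩ := (hS' s).1 hs
    exact h2 hl
  · exact h4 x hxW (hS'S ▸ hx.branch)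

end InnerModels

theorem theorem2p8 (V W : Set ZFSet.{u})
    (hV : InnerModels.IsTransitiveZFCModel V)
    (hW : InnerModels.IsInnerModel W V)
    (hCH : InnerModels.SatisfiesCH W)
    (hr : (InnerModels.realsOf V \ InnerModels.realsOf W).Nonempty) :
    InnerModels.InMarczewskiIdeal V (InnerModels.realsOf W) :=
  InnerModels.inMarczewskiIdeal_of_isInnerModel hV hW hCH hr
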